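/- Let $\Omega=\prod_{j=1}^3(0,\ell_j)$ be a box and let $\mathcal T_h$ be a conforming decomposition of $\Omega$ into nondegenerate convex hexahedra (polyhedra with planar faces and the face structure of a cube) that is combinatorially equivalent to the uniform $N_x\times N_y\times N_z$ decomposition ($N_x,N_y,N_z\ge 1$), its topological sides lying on the corresponding sides of $\Omega$, and such that any two boundary faces in opposite periodic position are translates of each other by the period. For a face $f$ let $\sigma_f$ be one of the following functionals on polynomials of degree at most $1$ (the same choice for all faces): (i) the face average $\sigma_f(u)=\frac1{|f|}\int_f u\,ds$, in which case all cells are moreover assumed to be parallelepipeds; or (m) the midpoint value $\sigma_f(u)=u(m_f)$, where $m_f$ is the mean of the four vertices of $f$ (general convex hexahedra). Let $$V^h=\{v\in L^2(\Omega) : v|_K\in\mathcal P_1(K)\ \forall K\in\mathcal T_h,\ \sigma_f(v|_{K^+})=\sigma_f(v|_{K^-})\text{ for every interior face } f=K^+\cap K^-\},$$ $$V^h_\#=\{v\in V^h : \sigma_{f_1}(v)=\sigma_{f_2}(v)\text{ for every pair }(f_1,f_2)\text{ of opposite boundary faces}\}.$$ The discrete periodic boundary conditions are the conditions $\sigma_{f_1}(v)=\sigma_{f_2}(v)$,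 one for each pair $(f_1,f_2)$ of opposite boundary faces. A set of them is called minimally essential if every $v\in V^h$ that satisfies the conditions in the set satisfies all discrete periodic boundary conditions, while no proper subset of the set has this property. Put $\mathfrak e(j)=\frac{1+(-1)^j}{2}$. Then minimally essential sets exist, and every one of them has exactly $$(N_xN_y+N_yN_z+N_zN_x)-\left[N_x\mathfrak e(N_y)\mathfrak e(N_z)+N_y\mathfrak e(N_x)\mathfrak e(N_z)+N_z\mathfrak e(N_x)\mathfrak e(N_y)-\mathfrak e(N_x)\mathfrak e(N_y)\mathfrak e(N_z)\right]$$ elements. Moreover $V^h_\#$ is finite-dimensional and $$\dim V^h_\#=N_xN_yN_z+\left[N_x\mathfrak e(N_y)\mathfrak e(N_z)+N_y\mathfrak e(N_x)\mathfrak e(N_z)+N_z\mathfrak e(N_x)\mathfrak e(N_y)-\mathfrak e(N_x)\mathfrak e(N_y)\mathfrak e(N_z)\right].$$ -/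

import Mathlib

open MeasureTheory

noncomputable section

namespace PeriodicP1NC

/-- Three-dimensional Euclidean space. -/
abbrev E3 : Type := EuclideanSpace ℝ (Fin 3)

/-- The space `𝒫₁` of polynomials of degree at most one in three variables. -/
abbrev P1 : Type := E3 →ᵃ[ℝ] ℝ

/-! ### The combinatorial `N₀ × N₁ × N₂` grid -/

/-- The cells of the `N₀ × N₁ × N₂` grid, labelled by their smallest corner. -/
abbrev Cell (N : Fin 3 → ℕ) : Type := {c : Fin 3 → ℕ // ∀ k, c k < N k}

/-- The faces of the `N₀ × N₁ × N₂` grid. The pair `(j, p)` stands for the face with smallest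
corner `p` that is perpendicular to the topological `j`-th direction. -/
abbrev Face (N : Fin 3 → ℕ) : Type :=
  {f : Fin 3 × (Fin 3 → ℕ) // f.2 f.1 ≤ N f.1 ∧ ∀ k, k ≠ f.1 → f.2 k < N k}

variable {N : Fin 3 → ℕ}

/-- The labels of the eight corners of a cell. -/
def Cell.corners (c : Cell N) : Finset (Fin 3 → ℕ) :=
  Fintype.piFinset fun k => {c.1 k, c.1 k + 1}

/-- The labels of the four corners of a face. -/
def Face.corners (f : Face N) : Finset (Fin 3 → ℕ) :=
  Fintype.piFinset fun k => if k = f.1.1 then {f.1.2 k} else {f.1.2 k, f.1.2 k + 1}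

/-- The first one of the two faces of a cell that are perpendicular to the `j`-th direction. -/
def Cell.lower (c : Cell N) (j : Fin 3) : Face N :=
  ⟨(j, c.1), (c.2 j).le, fun k _ => c.2 k⟩

/-- The second one of the two faces of a cell that are perpendicular to the `j`-th direction. -/
def Cell.upper (c : Cell N) (j : Fin 3) : Face N :=
  ⟨(j, c.1 + Pi.single j 1), by simpa using Nat.succ_le_of_lt (c.2 j),
    fun k hk => by simpa [Pi.single_apply, hk] using c.2 k⟩

/-- `c'` is the neighbour of `c` in the positive `j`-th direction, so that
`c.upper j = c'.lower j` is an interior face of the grid. -/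
def Cell.Next (c : Cell N) (j : Fin 3) (c' : Cell N) : Prop :=
  c'.1 = c.1 + Pi.single j 1

/-- The pairs of boundary faces on opposite boundary position. The triple `(j, c, c')` stands for
the pair `(c.lower j, c'.upper j)`, where `c` is the first and `c'` the last cell of one and the
same row of cells in the `j`-th direction. -/
abbrev OppPair (N : Fin 3 → ℕ) : Type :=
  {q : Fin 3 × Cell N × Cell N //
    q.2.1.1 q.1 = 0 ∧ q.2.2.1 q.1 + 1 = N q.1 ∧ ∀ k, k ≠ q.1 → q.2.2.1 k = q.2.1.1 k}

/-! ### Hexahedral meshes of a box -/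

/-- The open box `Ω = (0, ℓ₀) × (0, ℓ₁) × (0, ℓ₂)`. -/
def box (ℓ : Fin 3 → ℝ) : Set E3 := {x | ∀ k, 0 < x k ∧ x k < ℓ k}

/-- The closed box. -/
def closedBox (ℓ : Fin 3 → ℝ) : Set E3 := {x | ∀ k, 0 ≤ x k ∧ x k ≤ ℓ k}

/-- A conforming decomposition of the box `Ω = ∏ (0, ℓ k)` into convex hexahedra which is
combinatorially equivalent to the uniform `N₀ × N₁ × N₂` decomposition, and in which faces on
opposite boundary position are translates of each other. The values of `node` at labels `p`
outside `∏ {0, …, N k}` play no role. -/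
structure HexMesh (ℓ : Fin 3 → ℝ) (N : Fin 3 → ℕ) where
  len_pos : ∀ k, 0 < ℓ k
  count_pos : ∀ k, 0 < N k
  /-- the nodes of the mesh -/
  node : (Fin 3 → ℕ) → E3
  /-- Each cell is a (nondegenerate) convex polyhedron with the face structure of a cube: each of
  its six combinatorial faces is cut out by a supporting plane. -/
  supporting : ∀ (c : Cell N) (j : Fin 3), ∀ f ∈ ({c.lower j, c.upper j} : Set (Face N)),
    ∃ (φ : E3 →ₗ[ℝ] ℝ) (r : ℝ), ∀ p ∈ c.corners,
      (p ∈ f.corners → φ (node p) = r) ∧ (p ∉ f.corners → φ (node p) < r)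
  /-- The cells cover the box. -/
  cover : (⋃ c : Cell N, convexHull ℝ (node '' (c.corners : Set (Fin 3 → ℕ)))) = closedBox ℓ
  /-- Two cells meet exactly in their common face, edge or node (if any). -/
  conforming : ∀ c c' : Cell N,
    convexHull ℝ (node '' (c.corners : Set (Fin 3 → ℕ))) ∩
      convexHull ℝ (node '' (c'.corners : Set (Fin 3 → ℕ))) =
    convexHull ℝ (node '' ((c.corners ∩ c'.corners : Finset (Fin 3 → ℕ)) : Set (Fin 3 → ℕ)))
  /-- The topological sides of the grid lie on the corresponding sides of the box. -/
  side_zero : ∀ (j : Fin 3) (p : Fin 3 → ℕ), (∀ k, p k ≤ N k) → p j = 0 → node p j = 0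
  /-- Opposite boundary faces are congruent by translation. -/
  periodic : ∀ (j : Fin 3) (p : Fin 3 → ℕ), (∀ k, p k ≤ N k) → p j = 0 →
    node (p + Pi.single j (N j)) = node p + EuclideanSpace.single j (ℓ j)

namespace HexMesh

variable {ℓ : Fin 3 → ℝ} (T : HexMesh ℓ N)

/-- The (closed) hexahedron with label `c`. -/
def cell (c : Cell N) : Set E3 :=
  convexHull ℝ (T.node '' (c.corners : Set (Fin 3 → ℕ)))

/-- The (closed) face with label `f`, a planar convex quadrilateral. -/
def face (f : Face N) : Set E3 :=
  convexHull ℝ (T.node '' (f.corners : Set (Fin 3 → ℕ)))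

/-- All cells of the mesh are parallelepipeds: corners which are opposite in a face, or in the
cell, have the same midpoint as the other opposite corners. -/
def IsParallelepiped : Prop :=
  ∀ c : Cell N, ∀ p ∈ c.corners, ∀ q ∈ c.corners, ∀ p' ∈ c.corners, ∀ q' ∈ c.corners,
    p + q = p' + q' → T.node p + T.node q = T.node p' + T.node q'

/-- The midpoint `m_f` of a face, the mean of its four corners. -/
def midpoint (f : Face N) : E3 := (1 / 4 : ℝ) • ∑ p ∈ f.corners, T.node p

/-- The functional `σ_f^{(m)}(u) = u(m_f)`. -/
def midpointValue (f : Face N) : P1 →ₗ[ℝ] ℝ where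
  toFun u := u (T.midpoint f)
  map_add' _ _ := rfl
  map_smul' _ _ := rfl

/-- Each face is contained in a plane. -/
theorem exists_plane (f : Face N) :
    ∃ (φ : E3 →ₗ[ℝ] ℝ) (r : ℝ), φ ≠ 0 ∧ ∀ x ∈ T.face f, φ x = r := by
  obtain ⟨⟨j, p⟩, h1, h2⟩ := f
  dsimp only at h1 h2
  have key : ∃ c : Cell N, ∃ q ∈ c.corners, ∃ g ∈ ({c.lower j, c.upper j} : Set (Face N)),
      g = ⟨(j, p), h1, h2⟩ ∧ g.corners ⊆ c.corners ∧ q ∉ g.corners := by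
    have hN := T.count_pos j
    rcases h1.lt_or_eq with h | h
    · refine ⟨⟨p, fun k => ?_⟩, p + Pi.single j 1, ?_, _, Or.inl rfl, rfl, ?_, ?_⟩
      · by_cases hk : k = j
        · subst hk; exact h
        · exact h2 k hk
      · simp only [Cell.corners, Fintype.mem_piFinset]
        intro k
        by_cases hk : k = j
        · subst hk; simp
        · simp [hk]
      · intro q hq
        simp only [Cell.corners, Face.corners, Cell.lower, Fintype.mem_piFinset] at hq ⊢
        intro k
        have := hq k
        by_cases hk : k = j
        · subst hk; simp at this; simp [this]
        · simpa [hk] using this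
      · simp only [Face.corners, Cell.lower, Fintype.mem_piFinset]
        intro hq
        simpa using hq j
    · have hp : (p - Pi.single j 1) + Pi.single j 1 = p := by
        funext k
        by_cases hk : k = j
        · subst hk; simp; omega
        · simp [hk]
      refine ⟨⟨p - Pi.single j 1, fun k => ?_⟩, p - Pi.single j 1, ?_, _, Or.inr rfl, ?_, ?_, ?_⟩
      · by_cases hk : k = j
        · subst hk; simp; omega
        · simpa [Pi.single_apply, hk] using h2 k hk
      · simp only [Cell.corners, Fintype.mem_piFinset]
        intro k
        simp
      · simp only [Cell.upper, hp]
      · intro q hq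
        simp only [Cell.corners, Face.corners, Cell.upper, Fintype.mem_piFinset, hp] at hq ⊢
        intro k
        have := hq k
        by_cases hk : k = j
        · subst hk; simp at this; simp [this]; omega
        · simpa [hk, Pi.single_apply] using this
      · simp only [Face.corners, Cell.upper, Fintype.mem_piFinset, hp]
        intro hq
        have := hq j
        simp at this
        omega
  obtain ⟨c, q, hq, g, hg, rfl, hsub, hqg⟩ := key
  obtain ⟨φ, r, hφ⟩ := T.supporting c j _ hg
  refine ⟨φ, r, ?_, ?_⟩
  · rintro rfl
    have h3 := (hφ q hq).2 hqg
    have hp : p ∈ Face.corners (N := N) ⟨(j, p), h1, h2⟩ := by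
      simp only [Face.corners, Fintype.mem_piFinset]
      intro k
      by_cases hk : k = j <;> simp [hk]
    have h4 := (hφ p (hsub hp)).1 hp
    simp at h3 h4
    exact absurd h3 (by rw [← h4]; exact lt_irrefl _)
  · have : T.face ⟨(j, p), h1, h2⟩ ⊆ {x | φ x = r} := by
      refine convexHull_min ?_ (convex_hyperplane φ.isLinear r)
      rintro _ ⟨p', hp', rfl⟩
      exact (hφ p' (hsub hp')).1 hp'
    exact fun x hx => this hx

theorem isCompact_face (f : Face N) : IsCompact (T.face f) :=
  ((f.corners.finite_toSet).image _).isCompact_convexHull ℝ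

/-- The area of a face is finite. -/
theorem area_face_lt_top (f : Face N) : (μHE[2] : Measure E3) (T.face f) < ⊤ := by
  obtain ⟨φ, r, hφ, hf⟩ := T.exists_plane f
  rcases (T.face f).eq_empty_or_nonempty with h0 | ⟨x₀, hx₀⟩
  · simp [h0]
  have hrank : Module.finrank ℝ (LinearMap.ker φ) = 2 := by
    have h1 := LinearMap.finrank_range_add_finrank_ker φ
    rw [LinearMap.range_eq_top.2 (LinearMap.surjective hφ)] at h1
    simp at h1
    omega
  let e : EuclideanSpace ℝ (Fin 2) ≃ₗᵢ[ℝ] LinearMap.ker φ :=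
    ((stdOrthonormalBasis ℝ (LinearMap.ker φ)).reindex (finCongr hrank)).repr.symm
  let g : EuclideanSpace ℝ (Fin 2) → E3 := fun y => (e y : E3) + x₀
  have hg : Isometry g :=
    (IsometryEquiv.addRight x₀).isometry.comp (isometry_subtype_coe.comp e.isometry)
  have himg : T.face f = g '' (g ⁻¹' T.face f) := by
    rw [Set.image_preimage_eq_of_subset]
    intro x hx
    have hx' : x - x₀ ∈ LinearMap.ker φ := by
      simp [LinearMap.mem_ker, hf x hx, hf x₀ hx₀]
    exact ⟨e.symm ⟨x - x₀, hx'⟩, by simp [g]⟩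
  rw [himg, hg.euclideanHausdorffMeasure_image, EuclideanSpace.euclideanHausdorffMeasure_eq_volume]
  exact (hg.isClosedEmbedding.isCompact_preimage (T.isCompact_face f)).measure_lt_top

theorem integrableOn_face (f : Face N) (u : P1) :
    IntegrableOn (fun x => u x) (T.face f) (μHE[2] : Measure E3) := by
  have hu : Continuous (fun x => u x) := u.continuous_of_finiteDimensional
  obtain ⟨C, hC⟩ := (T.isCompact_face f).exists_bound_of_continuousOn hu.continuousOn
  refine Measure.integrableOn_of_bounded (T.area_face_lt_top f).ne
    hu.measurable.aestronglyMeasurable (M := C) ?_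
  exact (ae_restrict_iff' (T.isCompact_face f).measurableSet).2 (Filter.Eventually.of_forall hC)

/-- The functional `σ_f^{(i)}(u) = |f|⁻¹ ∫_f u ds`, with `ds` the surface measure. -/
def faceAverage (f : Face N) : P1 →ₗ[ℝ] ℝ where
  toFun u := ⨍ x in T.face f, u x ∂(μHE[2] : Measure E3)
  map_add' u v := by
    simp only [setAverage_eq]
    rw [← smul_add, ← integral_add (T.integrableOn_face f u) (T.integrableOn_face f v)]
    rfl
  map_smul' a u := by
    simp only [setAverage_eq, RingHom.id_apply]
    rw [smul_comm, ← integral_smul a]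
    rfl

/-! ### The finite element spaces -/

/-- `L²(Ω)`. -/
abbrev L2 (ℓ : Fin 3 → ℝ) : Type := Lp ℝ 2 ((volume : Measure E3).restrict (box ℓ))

/-- The element `v` of `L²(Ω)` coincides on each cell `K` with the polynomial `P K`. -/
def PiecewiseP1 (v : L2 ℓ) (P : Cell N → P1) : Prop :=
  ∀ c : Cell N, ∀ᵐ x ∂((volume : Measure E3).restrict (box ℓ)), x ∈ T.cell c → v x = P c x

theorem PiecewiseP1.zero : T.PiecewiseP1 0 0 := by
  intro c
  filter_upwards [Lp.coeFn_zero ℝ 2 ((volume : Measure E3).restrict (box ℓ))] with x hx _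
  exact hx

variable {T} in
theorem PiecewiseP1.add {v w : L2 ℓ} {P Q : Cell N → P1} (hv : T.PiecewiseP1 v P)
    (hw : T.PiecewiseP1 w Q) : T.PiecewiseP1 (v + w) (P + Q) := by
  intro c
  filter_upwards [hv c, hw c, Lp.coeFn_add v w] with x h1 h2 h3 hx
  rw [h3, Pi.add_apply, h1 hx, h2 hx]
  rfl

variable {T} in
theorem PiecewiseP1.smul {v : L2 ℓ} {P : Cell N → P1} (a : ℝ) (hv : T.PiecewiseP1 v P) :
    T.PiecewiseP1 (a • v) (a • P) := by
  intro c
  filter_upwards [hv c, Lp.coeFn_smul a v] with x h1 h3 hx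
  rw [h3, Pi.smul_apply, h1 hx]
  rfl

variable (σ : Face N → P1 →ₗ[ℝ] ℝ)

/-- The space `V^h`, for a choice `σ` of the face functionals: the piecewise linear functions `v`
such that `σ_f` of the jump of `v` vanishes for all interior faces `f`. -/
def V : Submodule ℝ (L2 ℓ) where
  carrier := {v | ∃ P : Cell N → P1, T.PiecewiseP1 v P ∧
    ∀ (c : Cell N) (j : Fin 3) (c' : Cell N), c.Next j c' →
      σ (c.upper j) (P c) = σ (c.upper j) (P c')}
  zero_mem' := ⟨0, .zero T, by simp⟩
  add_mem' := by
    rintro v w ⟨P, hP, hP'⟩ ⟨Q, hQ, hQ'⟩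
    exact ⟨P + Q, hP.add hQ, fun c j c' h => by simp [hP' c j c' h, hQ' c j c' h]⟩
  smul_mem' := by
    rintro a v ⟨P, hP, hP'⟩
    exact ⟨a • P, hP.smul a, fun c j c' h => by simp [hP' c j c' h]⟩

/-- The discrete boundary condition `σ_{f₁}(v) = σ_{f₂}(v)` attached to a pair `q = (f₁, f₂)` of
opposite boundary faces. -/
def PeriodicBC (q : OppPair N) (v : L2 ℓ) : Prop :=
  ∃ P : Cell N → P1, T.PiecewiseP1 v P ∧
    σ (q.1.2.1.lower q.1.1) (P q.1.2.1) = σ (q.1.2.2.upper q.1.1) (P q.1.2.2)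

/-- The periodic space `V^h_#`. -/
def Vper : Submodule ℝ (L2 ℓ) where
  carrier := {v | v ∈ T.V σ ∧ ∀ q : OppPair N, T.PeriodicBC σ q v}
  zero_mem' := ⟨zero_mem _, fun _ => ⟨0, .zero T, by simp⟩⟩
  add_mem' := by
    rintro v w ⟨hv, hv'⟩ ⟨hw, hw'⟩
    refine ⟨add_mem hv hw, fun q => ?_⟩
    obtain ⟨P, hP, hP'⟩ := hv' q
    obtain ⟨Q, hQ, hQ'⟩ := hw' q
    exact ⟨P + Q, hP.add hQ, by simp [hP', hQ']⟩
  smul_mem' := by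
    rintro a v ⟨hv, hv'⟩
    refine ⟨Submodule.smul_mem _ a hv, fun q => ?_⟩
    obtain ⟨P, hP, hP'⟩ := hv' q
    exact ⟨a • P, hP.smul a, by simp [hP']⟩

/-- The discrete boundary conditions in `S` induce all the discrete periodic boundary conditions
on functions of `V^h`. -/
def InducesAll (S : Finset (OppPair N)) : Prop :=
  ∀ v ∈ T.V σ, (∀ q ∈ S, T.PeriodicBC σ q v) → ∀ q : OppPair N, T.PeriodicBC σ q v

/-- A set of discrete periodic boundary conditions is minimally essential if it induces all the
others, but none of its proper subsets does. -/
def MinimallyEssential (S : Finset (OppPair N)) : Prop :=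
  T.InducesAll σ S ∧ ∀ S' : Finset (OppPair N), S' ⊂ S → ¬ T.InducesAll σ S'

end HexMesh

/-- The parity indicator `𝔢(j) = (1 + (-1)^j) / 2`. -/
def parity (j : ℕ) : ℚ := (1 + (-1) ^ j) / 2

end PeriodicP1NC

end

noncomputable section

namespace PeriodicP1NC

variable {N : Fin 3 → ℕ}

/-! ### Minimal families of linear conditions -/

theorem finrank_eq_card_add_of_minimal {W ι : Type*} [AddCommGroup W] [Module ℝ W]
    [FiniteDimensional ℝ W] [DecidableEq ι] (B : ι → W →ₗ[ℝ] ℝ) (S : Finset ι)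
    (h1 : ∀ w, (∀ q ∈ S, B q w = 0) → ∀ q, B q w = 0)
    (h2 : ∀ S' ⊂ S, ¬ ∀ w, (∀ q ∈ S', B q w = 0) → ∀ q, B q w = 0) :
    Module.finrank ℝ W =
      S.card + Module.finrank ℝ (⨅ q, LinearMap.ker (B q) : Submodule ℝ W) := by
  let f : W →ₗ[ℝ] (S → ℝ) := LinearMap.pi fun q => B q
  have hker : LinearMap.ker f = ⨅ q, LinearMap.ker (B q) := by
    ext w
    simp only [Submodule.mem_iInf, LinearMap.mem_ker, f, funext_iff, LinearMap.pi_apply,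
      Pi.zero_apply, Subtype.forall]
    exact ⟨h1 w, fun h q _ => h q⟩
  have hsingle : ∀ q : S, ∃ w, f w = Pi.single q 1 := by
    rintro ⟨q, hq⟩
    have h3 := h2 _ (Finset.erase_ssubset hq)
    push Not at h3
    obtain ⟨w, hw, q', hq'⟩ := h3
    have hne : B q w ≠ 0 := by
      intro h0
      refine hq' (h1 w (fun r hr => ?_) q')
      by_cases hrq : r = q
      · rw [hrq, h0]
      · exact hw r (Finset.mem_erase.2 ⟨hrq, hr⟩)
    refine ⟨(B q w)⁻¹ • w, ?_⟩
    ext ⟨r, hr⟩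
    by_cases hrq : r = q
    · subst hrq
      simp [f, hne]
    · simp [f, hrq, hw r (Finset.mem_erase.2 ⟨hrq, hr⟩)]
  have hsurj : LinearMap.range f = ⊤ := by
    rw [eq_top_iff, ← (Pi.basisFun ℝ S).span_eq, Submodule.span_le]
    rintro _ ⟨q, rfl⟩
    obtain ⟨w, hw⟩ := hsingle q
    exact ⟨w, by simp [hw]⟩
  have h := LinearMap.finrank_range_add_finrank_ker f
  rw [hsurj, hker, finrank_top, Module.finrank_fintype_fun_eq_card, Fintype.card_coe] at h
  exact h.symm

/-! ### Functions with vanishing alternating sums -/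

/-- The `K`-valued functions on `Fin n` whose alternating sum vanishes if `n` is even. -/
def altKer {M : Type*} [AddCommGroup M] [Module ℝ M] (n : ℕ) (K : Submodule ℝ M) :
    Submodule ℝ (Fin n → M) where
  carrier := {s | (∀ i, s i ∈ K) ∧ (Even n → ∑ i : Fin n, (-1 : ℝ) ^ (i : ℕ) • s i = 0)}
  zero_mem' := ⟨fun _ => zero_mem _, by simp⟩
  add_mem' := by
    rintro s t ⟨h1, h2⟩ ⟨h3, h4⟩
    refine ⟨fun i => add_mem (h1 i) (h3 i), fun h => ?_⟩
    simp [smul_add, Finset.sum_add_distrib, h2 h, h4 h]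
  smul_mem' := by
    rintro a s ⟨h1, h2⟩
    refine ⟨fun i => K.smul_mem a (h1 i), fun h => ?_⟩
    simp [smul_comm _ a, ← Finset.smul_sum, h2 h]

/-- The natural-number version of the parity indicator. -/
def natParity (n : ℕ) : ℕ := if Even n then 1 else 0

theorem finrank_altKer {M : Type*} [AddCommGroup M] [Module ℝ M] [FiniteDimensional ℝ M]
    {n : ℕ} (hn : 0 < n) (K : Submodule ℝ M) :
    Module.finrank ℝ (altKer n K) = (n - natParity n) * Module.finrank ℝ K := by
  have hall : Module.finrank ℝ (Fin n → K) = n * Module.finrank ℝ K := by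
    rw [Module.finrank_pi_fintype]; simp
  by_cases he : Even n
  · let A : (Fin n → K) →ₗ[ℝ] K := ∑ i : Fin n, (-1 : ℝ) ^ (i : ℕ) • LinearMap.proj i
    have hA : LinearMap.range A = ⊤ := by
      rw [LinearMap.range_eq_top]
      intro k
      refine ⟨Pi.single ⟨0, hn⟩ k, ?_⟩
      simp only [A, LinearMap.sum_apply, LinearMap.smul_apply, LinearMap.proj_apply]
      rw [Finset.sum_eq_single ⟨0, hn⟩] <;> simp +contextual
    have h := LinearMap.finrank_range_add_finrank_ker A
    rw [hA, finrank_top, hall] at h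
    let e : LinearMap.ker A ≃ₗ[ℝ] altKer n K :=
      { toFun := fun s => ⟨fun i => (s.1 i : M), fun i => (s.1 i).2, fun _ => by
          have h := s.2
          rw [LinearMap.mem_ker] at h
          have h' : ((A s.1 : K) : M) = 0 := by rw [h]; rfl
          simpa [A, -LinearMap.map_coe_ker] using h'⟩
        invFun := fun s => ⟨fun i => ⟨s.1 i, s.2.1 i⟩, by
          rw [LinearMap.mem_ker]
          apply Subtype.ext
          simpa [A] using s.2.2 he⟩
        map_add' := fun _ _ => rfl
        map_smul' := fun _ _ => rfl
        left_inv := fun _ => rfl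
        right_inv := fun _ => rfl }
    rw [← e.finrank_eq, natParity, if_pos he, Nat.sub_mul]
    omega
  · let e : (Fin n → K) ≃ₗ[ℝ] altKer n K :=
      { toFun := fun s => ⟨fun i => (s i : M), fun i => (s i).2, fun h => absurd h he⟩
        invFun := fun s => fun i => ⟨s.1 i, s.2.1 i⟩
        map_add' := fun _ _ => rfl
        map_smul' := fun _ _ => rfl
        left_inv := fun _ => rfl
        right_inv := fun _ => rfl }
    rw [← e.finrank_eq, natParity, if_neg he, hall, Nat.sub_zero]

/-! ### Rows of cells -/

/-- The values of a cell function, extended by zero. -/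
def ext : (Cell N → ℝ) →ₗ[ℝ] ((Fin 3 → ℕ) → ℝ) where
  toFun s p := if h : ∀ k, p k < N k then s ⟨p, h⟩ else 0
  map_add' s t := by ext p; by_cases h : ∀ k, p k < N k <;> simp [h]
  map_smul' a s := by ext p; by_cases h : ∀ k, p k < N k <;> simp [h]

theorem ext_coe (s : Cell N → ℝ) (c : Cell N) : ext s c.1 = s c := by
  simp [ext, c.2]

/-- The alternating sum of a cell function over the first `n` cells of the row through `p` in
the `j`-th direction. -/
def altSum (p : Fin 3 → ℕ) (j : Fin 3) (n : ℕ) : (Cell N → ℝ) →ₗ[ℝ] ℝ :=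
  ∑ t ∈ Finset.range n, (-1 : ℝ) ^ t • (LinearMap.proj (Function.update p j t) ∘ₗ ext)

theorem altSum_apply (p : Fin 3 → ℕ) (j : Fin 3) (n : ℕ) (s : Cell N → ℝ) :
    altSum p j n s = ∑ t ∈ Finset.range n, (-1 : ℝ) ^ t * ext s (Function.update p j t) := by
  simp [altSum]

theorem altSum_update (p : Fin 3 → ℕ) (j : Fin 3) (n i : ℕ) :
    altSum (N := N) (Function.update p j i) j n = altSum p j n := by
  simp [altSum]

theorem update_lt (c : Cell N) (j : Fin 3) {i : ℕ} (hi : i < N j) (k : Fin 3) :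
    Function.update c.1 j i k < N k := by
  by_cases hk : k = j
  · subst hk; simpa using hi
  · simpa [hk] using c.2 k

/-- The pair of boundary faces at the ends of the row through `c` in the `j`-th direction. -/
def Cell.row (c : Cell N) (j : Fin 3) : OppPair N :=
  ⟨(j, ⟨Function.update c.1 j 0, update_lt c j (Nat.zero_lt_of_lt (c.2 j))⟩,
    ⟨Function.update c.1 j (N j - 1), update_lt c j (by have := c.2 j; omega)⟩), by
    have := c.2 j
    refine ⟨by simp, by simp; omega, fun k hk => ?_⟩
    dsimp only at hk ⊢
    simp [hk]⟩

theorem OppPair.ext_first {q q' : OppPair N} (h1 : q.1.1 = q'.1.1)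
    (h2 : q.1.2.1 = q'.1.2.1) : q = q' := by
  obtain ⟨⟨j, c, d⟩, h, h', h''⟩ := q
  obtain ⟨⟨j', c', d'⟩, g, g', g''⟩ := q'
  dsimp only at *
  subst h1 h2
  have : d = d' := by
    apply Subtype.ext
    funext k
    by_cases hk : k = j
    · subst hk; dsimp only at h' g'; omega
    · rw [h'' k hk, g'' k hk]
  subst this
  rfl

theorem row_first (q : OppPair N) : q.1.2.1.row q.1.1 = q := by
  refine OppPair.ext_first rfl (Subtype.ext ?_)
  simp [Cell.row, ← q.2.1]

theorem row_eq_of_update {c c' : Cell N} {j : Fin 3} {i : ℕ}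
    (h : c'.1 = Function.update c.1 j i) : c'.row j = c.row j := by
  refine OppPair.ext_first rfl (Subtype.ext ?_)
  simp [Cell.row, h]

theorem row_last (q : OppPair N) : q.1.2.2.row q.1.1 = q := by
  conv_rhs => rw [← row_first q]
  refine row_eq_of_update (i := q.1.2.2.1 q.1.1) ?_
  funext k
  by_cases hk : k = q.1.1
  · subst hk; simp
  · simp [hk, q.2.2.2 k hk]

/-! ### The counting of cells and rows -/

/-- A cell is determined by its three coordinates. -/
def cellEquiv : Cell N ≃ ((k : Fin 3) → Fin (N k)) where
  toFun c k := ⟨c.1 k, c.2 k⟩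
  invFun f := ⟨fun k => f k, fun k => (f k).2⟩
  left_inv _ := rfl
  right_inv _ := rfl

instance : Fintype (Cell N) := Fintype.ofEquiv _ cellEquiv.symm

instance : Fintype (OppPair N) :=
  Fintype.ofInjective (fun q : OppPair N => (q.1.1, q.1.2.1))
    fun _ _ h => OppPair.ext_first (Prod.mk.inj h).1 (Prod.mk.inj h).2

theorem card_cell : Fintype.card (Cell N) = ∏ k, N k := by
  rw [Fintype.card_congr cellEquiv, Fintype.card_pi]
  simp

theorem card_rows_mul (j : Fin 3) :
    Fintype.card {q : OppPair N // q.1.1 = j} * N j = ∏ k, N k := by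
  let e : Cell N ≃ {q : OppPair N // q.1.1 = j} × Fin (N j) :=
    { toFun := fun c => (⟨c.row j, rfl⟩, ⟨c.1 j, c.2 j⟩)
      invFun := fun x => ⟨Function.update x.1.1.1.2.1.1 j x.2, update_lt _ _ x.2.2⟩
      left_inv := fun c => by
        apply Subtype.ext
        simp [Cell.row]
      right_inv := by
        rintro ⟨⟨q, rfl⟩, i⟩
        refine Prod.ext (Subtype.ext ?_) (Fin.ext ?_)
        · dsimp only
          rw [row_eq_of_update (c := q.1.2.1) rfl, row_first]
        · simp }
  rw [← card_cell, Fintype.card_congr e, Fintype.card_prod, Fintype.card_fin]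

theorem card_rows (hN : ∀ k, 0 < N k) (j : Fin 3) :
    Fintype.card {q : OppPair N // q.1.1 = j} = ∏ k ∈ Finset.univ.erase j, N k := by
  apply Nat.eq_of_mul_eq_mul_right (hN j)
  rw [card_rows_mul, Finset.prod_erase_mul _ _ (Finset.mem_univ j)]

theorem card_oppPair (hN : ∀ k, 0 < N k) :
    Fintype.card (OppPair N) = ∑ j, ∏ k ∈ Finset.univ.erase j, N k := by
  simp_rw [← card_rows hN]
  rw [← Finset.card_univ,
    Finset.card_eq_sum_card_fiberwise (f := fun q : OppPair N => q.1.1) (t := Finset.univ)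
      (fun _ _ => Finset.mem_coe.2 (Finset.mem_univ _))]
  simp [Fintype.card_subtype]

theorem card_even_oppPair (hN : ∀ k, 0 < N k) :
    Fintype.card {q : OppPair N // Even (N q.1.1)} =
      ∑ j, natParity (N j) * ∏ k ∈ Finset.univ.erase j, N k := by
  simp_rw [← card_rows hN]
  rw [Fintype.card_subtype,
    Finset.card_eq_sum_card_fiberwise (f := fun q : OppPair N => q.1.1) (t := Finset.univ)
      (fun _ _ => Finset.mem_coe.2 (Finset.mem_univ _))]
  refine Finset.sum_congr rfl fun j _ => ?_
  rw [Fintype.card_subtype, Finset.filter_filter, natParity]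
  split_ifs with h
  · rw [one_mul]
    congr 1
    ext q
    simp only [Finset.mem_filter, Finset.mem_univ, true_and]
    exact ⟨fun h => h.2, fun h' => ⟨by rw [h']; exact h, h'⟩⟩
  · rw [zero_mul, Finset.card_eq_zero, Finset.filter_eq_empty_iff]
    rintro q - ⟨h1, h2⟩
    rw [h2] at h1
    exact h h1

/-! ### Coordinates of the nonconforming space -/

/-- The values on the cells stand for the sums of the values on opposite faces, the values on the
rows for the values on the first faces of the rows. -/
abbrev Coord (N : Fin 3 → ℕ) : Type := (Cell N → ℝ) × (OppPair N → ℝ)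

/-- The value on the lower `j`-th face of a cell. -/
def gridVal (c : Cell N) (j : Fin 3) : Coord N →ₗ[ℝ] ℝ :=
  (-1 : ℝ) ^ c.1 j • (LinearMap.proj (c.row j) ∘ₗ
    LinearMap.snd ℝ (Cell N → ℝ) (OppPair N → ℝ) -
    altSum c.1 j (c.1 j) ∘ₗ LinearMap.fst ℝ (Cell N → ℝ) (OppPair N → ℝ))

theorem gridVal_apply (c : Cell N) (j : Fin 3) (d : Coord N) :
    gridVal c j d = (-1) ^ c.1 j * (d.2 (c.row j) - altSum c.1 j (c.1 j) d.1) := by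
  simp [gridVal]

/-- The defect of the discrete periodic boundary condition for a pair of boundary faces. -/
def bc (q : OppPair N) : Coord N →ₗ[ℝ] ℝ :=
  ((-1 : ℝ) ^ N q.1.1 - 1) • (LinearMap.proj q ∘ₗ
    LinearMap.snd ℝ (Cell N → ℝ) (OppPair N → ℝ)) -
    (-1 : ℝ) ^ N q.1.1 • (altSum q.1.2.1.1 q.1.1 (N q.1.1) ∘ₗ
      LinearMap.fst ℝ (Cell N → ℝ) (OppPair N → ℝ))

theorem bc_apply (q : OppPair N) (d : Coord N) :
    bc q d = ((-1) ^ N q.1.1 - 1) * d.2 q -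
      (-1) ^ N q.1.1 * altSum q.1.2.1.1 q.1.1 (N q.1.1) d.1 := by
  simp [bc]

theorem altSum_succ (c : Cell N) (j : Fin 3) (s : Cell N → ℝ) :
    altSum c.1 j (c.1 j + 1) s = altSum c.1 j (c.1 j) s + (-1) ^ c.1 j * s c := by
  rw [altSum_apply, Finset.sum_range_succ, ← altSum_apply, Function.update_eq_self, ext_coe]

theorem neg_one_pow_mul_self (n : ℕ) : (-1 : ℝ) ^ n * (-1) ^ n = 1 := by
  rw [← mul_pow]; simp

theorem gridVal_next {c c' : Cell N} {j : Fin 3} (h : c.Next j c') (d : Coord N) :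
    gridVal c' j d = d.1 c - gridVal c j d := by
  have h' : c'.1 = Function.update c.1 j (c.1 j + 1) := by
    rw [h]
    funext k
    by_cases hk : k = j
    · subst hk; simp
    · simp [hk]
  have hj : c'.1 j = c.1 j + 1 := by rw [h']; simp
  rw [gridVal_apply, gridVal_apply, row_eq_of_update h', hj, h', altSum_update, altSum_succ,
    pow_succ]
  linear_combination d.1 c * neg_one_pow_mul_self (c.1 j)

theorem gridVal_first (q : OppPair N) (d : Coord N) : gridVal q.1.2.1 q.1.1 d = d.2 q := by
  rw [gridVal_apply, q.2.1, row_first, altSum_apply]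
  simp

theorem gridVal_last (q : OppPair N) (d : Coord N) :
    d.1 q.1.2.2 - gridVal q.1.2.2 q.1.1 d - gridVal q.1.2.1 q.1.1 d = bc q d := by
  have h2 := q.2.2.1
  have h : q.1.2.2.1 = Function.update q.1.2.1.1 q.1.1 (q.1.2.2.1 q.1.1) := by
    funext k
    by_cases hk : k = q.1.1
    · subst hk; simp
    · simp [hk, q.2.2.2 k hk]
  have h3 := altSum_succ q.1.2.2 q.1.1 d.1
  rw [h2] at h3
  rw [gridVal_first, gridVal_apply, row_last, bc_apply]
  have h4 : altSum q.1.2.1.1 q.1.1 (N q.1.1) d.1 = altSum q.1.2.2.1 q.1.1 (N q.1.1) d.1 := by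
    rw [h, altSum_update]
  rw [h4, h3, ← h2, pow_succ]
  linear_combination (-d.1 q.1.2.2) * neg_one_pow_mul_self (q.1.2.2.1 q.1.1)

/-- Cell functions whose alternating sums vanish along all rows with an even number of cells. -/
def evenKer (N : Fin 3 → ℕ) : Submodule ℝ (Cell N → ℝ) :=
  ⨅ q : {q : OppPair N // Even (N q.1.1)},
    LinearMap.ker (altSum q.1.1.2.1.1 q.1.1.1 (N q.1.1.1))

theorem mem_evenKer {s : Cell N → ℝ} : s ∈ evenKer N ↔
    ∀ (c : Cell N) (j : Fin 3), Even (N j) → altSum c.1 j (N j) s = 0 := by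
  simp only [evenKer, Submodule.mem_iInf, LinearMap.mem_ker,
    Subtype.forall (p := fun q : OppPair N => Even (N q.1.1))]
  constructor
  · intro h c j hj
    have := h (c.row j) hj
    simpa [Cell.row, altSum_update] using this
  · intro h q hq
    exact h _ _ hq

theorem mem_iInf_ker_bc {d : Coord N} : d ∈ (⨅ q, LinearMap.ker (bc q) : Submodule ℝ (Coord N)) ↔
    d.1 ∈ evenKer N ∧
      ∀ q : OppPair N, ¬ Even (N q.1.1) → 2 * d.2 q = altSum q.1.2.1.1 q.1.1 (N q.1.1) d.1 := by
  simp only [evenKer, Submodule.mem_iInf, LinearMap.mem_ker,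
    Subtype.forall (p := fun q : OppPair N => Even (N q.1.1))]
  rw [← forall_and]
  refine forall_congr' fun q => ?_
  rw [bc_apply]
  by_cases h : Even (N q.1.1)
  · simp [h]
  · rw [(Nat.not_even_iff_odd.1 h).neg_one_pow]
    simp only [h, false_imp_iff, true_and, not_false_iff, true_imp_iff]
    constructor <;> intro h <;> linarith

open Classical in
theorem finrank_iInf_ker_bc (hN : ∀ k, 0 < N k) :
    Module.finrank ℝ (⨅ q, LinearMap.ker (bc q) : Submodule ℝ (Coord N)) =
      Module.finrank ℝ (evenKer N) +
        ∑ j, natParity (N j) * ∏ k ∈ Finset.univ.erase j, N k := by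
  let e : (⨅ q, LinearMap.ker (bc q) : Submodule ℝ (Coord N)) ≃ₗ[ℝ]
      evenKer N × ({q : OppPair N // Even (N q.1.1)} → ℝ) :=
    { toFun := fun d => (⟨d.1.1, (mem_iInf_ker_bc.1 d.2).1⟩, fun q => d.1.2 q)
      invFun := fun x => ⟨(x.1, fun q => if h : Even (N q.1.1) then x.2 ⟨q, h⟩ else
          altSum q.1.2.1.1 q.1.1 (N q.1.1) x.1.1 / 2), mem_iInf_ker_bc.2 ⟨x.1.2, fun q hq => by
            simp only [dif_neg hq]; ring⟩⟩
      map_add' := fun _ _ => rfl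
      map_smul' := fun _ _ => rfl
      left_inv := fun d => by
        refine Subtype.ext (Prod.ext rfl (funext fun q => ?_))
        by_cases h : Even (N q.1.1)
        · simp [h]
        · have := (mem_iInf_ker_bc.1 d.2).2 q h
          simp only [dif_neg h]
          linarith
      right_inv := fun x => by
        refine Prod.ext rfl (funext fun q => ?_)
        simp [q.2] }
  rw [e.finrank_eq, Module.finrank_prod, Module.finrank_fintype_fun_eq_card,
    card_even_oppPair hN]

/-- Cell functions as functions of the three coordinates. -/
def cellFunEquiv : (Cell N → ℝ) ≃ₗ[ℝ] (Fin (N 0) → Fin (N 1) → Fin (N 2) → ℝ) where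
  toFun s i j k := ext s ![i, j, k]
  invFun t c := t ⟨c.1 0, c.2 0⟩ ⟨c.1 1, c.2 1⟩ ⟨c.1 2, c.2 2⟩
  map_add' s t := by rw [map_add]; rfl
  map_smul' a s := by rw [map_smul]; rfl
  left_inv s := by
    funext c
    refine Eq.trans ?_ (ext_coe s c)
    refine congrArg (ext s) ?_
    funext k
    fin_cases k <;> rfl
  right_inv t := by
    funext i j k
    have h : ∀ l, ![(i : ℕ), j, k] l < N l := by
      intro l
      fin_cases l
      exacts [i.2, j.2, k.2]
    exact ext_coe _ ⟨_, h⟩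

theorem finrank_evenKer (hN : ∀ k, 0 < N k) :
    Module.finrank ℝ (evenKer N) = ∏ k, (N k - natParity (N k)) := by
  have h : evenKer N = (altKer (N 0) (altKer (N 1) (altKer (N 2) (⊤ : Submodule ℝ ℝ)))).comap
      (cellFunEquiv (N := N)).toLinearMap := by
    have h0 : ∀ (a b c i : ℕ), Function.update ![a, b, c] 0 i = ![i, b, c] := by
      intros; funext k; fin_cases k <;> rfl
    have h1 : ∀ (a b c i : ℕ), Function.update ![a, b, c] 1 i = ![a, i, c] := by
      intros; funext k; fin_cases k <;> rfl
    have h2 : ∀ (a b c i : ℕ), Function.update ![a, b, c] 2 i = ![a, b, i] := by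
      intros; funext k; fin_cases k <;> rfl
    have hcell : ∀ {Q : Cell N → Prop}, (∀ c, Q c) ↔ ∀ (i : Fin (N 0)) (j : Fin (N 1))
        (k : Fin (N 2)), Q ⟨![i, j, k], by
          intro l; fin_cases l; exacts [i.2, j.2, k.2]⟩ := by
      intro Q
      refine ⟨fun h _ _ _ => h _, fun h c => ?_⟩
      convert h ⟨c.1 0, c.2 0⟩ ⟨c.1 1, c.2 1⟩ ⟨c.1 2, c.2 2⟩ using 2
      funext k
      fin_cases k <;> rfl
    ext s
    rw [mem_evenKer, hcell]
    have hs : ∀ i j k, cellFunEquiv s i j k = ext s ![(i : ℕ), j, k] := fun _ _ _ => rfl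
    constructor
    · intro h
      refine ⟨fun i => ⟨fun j => ⟨fun k => trivial, fun he => ?_⟩, fun he => ?_⟩, fun he => ?_⟩
      · simpa [hs, altSum_apply, Finset.sum_range, h2] using h i j ⟨0, hN 2⟩ 2 he
      · funext k
        simpa [hs, altSum_apply, Finset.sum_range, h1] using h i ⟨0, hN 1⟩ k 1 he
      · funext j k
        simpa [hs, altSum_apply, Finset.sum_range, h0] using h ⟨0, hN 0⟩ j k 0 he
    · rintro ⟨h, h'⟩ i j k l he
      fin_cases l
      · simpa [hs, altSum_apply, Finset.sum_range, h0] using congrFun (congrFun (h' he) j) k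
      · simpa [hs, altSum_apply, Finset.sum_range, h1] using congrFun ((h i).2 he) k
      · simpa [hs, altSum_apply, Finset.sum_range, h2] using ((h i).1 j).2 he
  rw [h, LinearEquiv.finrank_eq ((cellFunEquiv (N := N)).ofSubmodule' _),
    finrank_altKer (hN 0), finrank_altKer (hN 1), finrank_altKer (hN 2), finrank_top,
    Module.finrank_self, Fin.prod_univ_three]
  ring

/-! ### Vertex values with vanishing face sums -/

/-- The relation between the edge sums and the diagonal sum of values with mean zero at the
corners of a convex quadrilateral. -/
def QuadBound (w₀₀ w₁₀ w₀₁ w₁₁ : ℝ) : Prop :=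
  (w₀₀ = 0 ∧ w₁₀ = 0 ∧ w₀₁ = 0 ∧ w₁₁ = 0) ∨
    |w₀₀ + w₁₁| < max |w₀₀ + w₁₀| |w₀₀ + w₀₁|

theorem quadBound {c₀₀ c₁₀ c₀₁ c₁₁ w₀₀ w₁₀ w₀₁ w₁₁ : ℝ} (h₀₀ : 0 < c₀₀) (h₁₀ : 0 < c₁₀)
    (h₀₁ : 0 < c₀₁) (h₁₁ : 0 < c₁₁) (hc : c₀₀ + c₁₁ = c₁₀ + c₀₁)
    (hw : c₀₀ * w₀₀ + c₁₁ * w₁₁ = c₁₀ * w₁₀ + c₀₁ * w₀₁) (hs : w₀₀ + w₁₀ + w₀₁ + w₁₁ = 0) :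
    QuadBound w₀₀ w₁₀ w₀₁ w₁₁ := by
  rw [QuadBound, or_iff_not_imp_right, not_lt, max_le_iff]
  rintro ⟨hA, hB⟩
  have key : (c₀₀ + c₁₁) * (w₀₀ + w₁₁) = (w₀₀ + w₁₀) * (c₁₀ - c₀₀) +
      (w₀₀ + w₀₁) * (c₁₁ - c₁₀) := by
    obtain rfl : c₀₁ = c₀₀ + c₁₁ - c₁₀ := by linarith
    obtain rfl : w₁₁ = -(w₀₀ + w₁₀ + w₀₁) := by linarith
    linear_combination hw
  have hlt : |c₁₀ - c₀₀| + |c₁₁ - c₁₀| < c₀₀ + c₁₁ := by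
    rcases abs_cases (c₁₀ - c₀₀) with h | h <;> rcases abs_cases (c₁₁ - c₁₀) with h' | h' <;>
      linarith
  have hle : (c₀₀ + c₁₁) * |w₀₀ + w₁₁| ≤ |w₀₀ + w₁₁| * (|c₁₀ - c₀₀| + |c₁₁ - c₁₀|) := by
    calc (c₀₀ + c₁₁) * |w₀₀ + w₁₁| = |(c₀₀ + c₁₁) * (w₀₀ + w₁₁)| := by
          rw [abs_mul, abs_of_pos (by linarith : 0 < c₀₀ + c₁₁)]
      _ ≤ |(w₀₀ + w₁₀) * (c₁₀ - c₀₀)| + |(w₀₀ + w₀₁) * (c₁₁ - c₁₀)| := by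
          rw [key]; exact abs_add_le _ _
      _ ≤ _ := by
          rw [abs_mul, abs_mul, mul_add]
          gcongr
  have hD : |w₀₀ + w₁₁| = 0 := by
    by_contra hne
    have hpos : 0 < |w₀₀ + w₁₁| := lt_of_le_of_ne (abs_nonneg _) (Ne.symm hne)
    nlinarith
  rw [hD] at hA hB
  have h1 := abs_eq_zero.1 hD
  have h2 := abs_eq_zero.1 (le_antisymm hA (abs_nonneg _))
  have h3 := abs_eq_zero.1 (le_antisymm hB (abs_nonneg _))
  refine ⟨?_, ?_, ?_, ?_⟩ <;> linarith

/-- The values `a i j k`, `i, j, k < 2`, at the corners of a cube have sum zero on each face. -/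
structure ZeroFaceSums (a : ℕ → ℕ → ℕ → ℝ) : Prop where
  x : ∀ i < 2, a i 0 0 + a i 1 0 + a i 0 1 + a i 1 1 = 0
  y : ∀ i < 2, a 0 i 0 + a 1 i 0 + a 0 i 1 + a 1 i 1 = 0
  z : ∀ i < 2, a 0 0 i + a 1 0 i + a 0 1 i + a 1 1 i = 0

theorem ZeroFaceSums.edge_bound {a : ℕ → ℕ → ℕ → ℝ} (h : ZeroFaceSums a)
    (hz : ∀ i < 2, QuadBound (a 0 0 i) (a 1 0 i) (a 0 1 i) (a 1 1 i)) :
    (∀ i < 2, ∀ j < 2, ∀ k < 2, a i j k = 0) ∨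
      |a 0 0 0 + a 0 0 1| < max |a 0 0 0 + a 1 0 0| |a 0 0 0 + a 0 1 0| := by
  have x0 := h.x 0 (by norm_num)
  have x1 := h.x 1 (by norm_num)
  have y0 := h.y 0 (by norm_num)
  have y1 := h.y 1 (by norm_num)
  have z0 := h.z 0 (by norm_num)
  have z1 := h.z 1 (by norm_num)
  have eA : |a 0 0 1 + a 1 0 1| = |a 0 0 0 + a 1 0 0| := by
    rw [← abs_neg]; congr 1; linarith
  have eB : |a 0 0 1 + a 0 1 1| = |a 0 0 0 + a 0 1 0| := by
    rw [← abs_neg]; congr 1; linarith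
  have e : a 0 0 0 + a 0 0 1 = ((a 0 0 0 + a 1 1 0) + (a 0 0 1 + a 1 1 1)) / 2 := by linarith
  have q0 := hz 0 (by norm_num)
  have q1 := hz 1 (by norm_num)
  rw [QuadBound] at q0 q1
  rw [eA, eB] at q1
  rcases q0 with ⟨h1, h2, h3, h4⟩ | q0
  · rw [h1, h2, h3] at q1
    rcases q1 with ⟨h5, h6, h7, h8⟩ | q1
    · left
      intro i hi j hj k hk
      interval_cases i <;> interval_cases j <;> interval_cases k <;> assumption
    · simp at q1
      exact absurd q1 (not_lt.2 (abs_nonneg _))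
  · rcases q1 with ⟨h5, h6, h7, h8⟩ | q1
    · rw [h5, h6, add_zero, abs_zero] at eA
      rw [h5, h7, add_zero, abs_zero] at eB
      rw [← eA, ← eB, max_self] at q0
      exact absurd q0 (not_lt.2 (abs_nonneg _))
    · right
      rw [e, abs_div, abs_two]
      have := abs_add_le (a 0 0 0 + a 1 1 0) (a 0 0 1 + a 1 1 1)
      linarith

theorem ZeroFaceSums.eq_zero {a : ℕ → ℕ → ℕ → ℝ} (h : ZeroFaceSums a)
    (hx : ∀ i < 2, QuadBound (a i 0 0) (a i 1 0) (a i 0 1) (a i 1 1))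
    (hy : ∀ i < 2, QuadBound (a 0 i 0) (a 1 i 0) (a 0 i 1) (a 1 i 1))
    (hz : ∀ i < 2, QuadBound (a 0 0 i) (a 1 0 i) (a 0 1 i) (a 1 1 i)) :
    ∀ i < 2, ∀ j < 2, ∀ k < 2, a i j k = 0 := by
  have hx' : ZeroFaceSums fun i j k => a k i j :=
    ⟨fun i hi => by linarith [h.y i hi], fun i hi => by linarith [h.z i hi], h.x⟩
  have hy' : ZeroFaceSums fun i j k => a i k j :=
    ⟨fun i hi => by linarith [h.x i hi], h.z, h.y⟩
  rcases h.edge_bound hz with h0 | h1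
  · exact h0
  rcases hx'.edge_bound hx with h0 | h2
  · exact fun i hi j hj k hk => h0 j hj k hk i hi
  rcases hy'.edge_bound hy with h0 | h3
  · exact fun i hi j hj k hk => h0 i hi k hk j hj
  exfalso
  rcases lt_max_iff.1 h1 with h1 | h1 <;> rcases lt_max_iff.1 h2 with h2 | h2 <;>
    rcases lt_max_iff.1 h3 with h3 | h3 <;> linarith

/-! ### Affine functions and convex quadrilaterals -/

theorem affine_eq (u : P1) (x : E3) : u x = u.linear x + u 0 := by
  rw [AffineMap.decomp u]; simp

theorem opposite_signs {p q x y : ℝ} (hp : p < 0) (hq : q < 0) (h : x * p + y * q = 0) :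
    (x = 0 ↔ y = 0) ∧ (0 < x ↔ y < 0) ∧ (x < 0 ↔ 0 < y) := by
  have hx : x = y * (-q / p) := by
    rw [mul_div_assoc', eq_div_iff hp.ne]; linarith
  have hpos : 0 < q / p := div_pos_of_neg_of_neg hq hp
  have hx' : x = -y * (q / p) := by rw [hx]; ring
  rw [hx']
  refine ⟨by simp [hp.ne, hq.ne], ?_, ?_⟩
  · rw [mul_pos_iff_of_pos_right hpos, neg_pos]
  · rw [mul_neg_iff]
    constructor
    · rintro (h | h) <;> linarith
    · intro h; right; exact ⟨by linarith, hpos⟩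

/-- The diagonals of a convex quadrilateral intersect in their interiors. -/
theorem exists_quad_relation {v : Fin 4 → E3} {φ : E3 →ₗ[ℝ] ℝ} {r : ℝ} (hφ : φ ≠ 0)
    (hv : ∀ i, φ (v i) = r) {ψ : Fin 4 → E3 →ₗ[ℝ] ℝ} {t : Fin 4 → ℝ}
    (h0 : ∀ i, ψ i (v i) = t i) (h1 : ∀ i, ψ i (v (i + 1)) = t i)
    (h2 : ∀ i, ψ i (v (i + 2)) < t i) (h3 : ∀ i, ψ i (v (i + 3)) < t i) :
    ∃ c : Fin 4 → ℝ, (∀ i, 0 < c i) ∧ c 0 + c 2 = c 1 + c 3 ∧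
      ∀ u : P1, c 0 * u (v 0) + c 2 * u (v 2) = c 1 * u (v 1) + c 3 * u (v 3) := by
  suffices H : ∃ c : Fin 4 → ℝ, (0 < c 0 ∧ c 1 < 0 ∧ 0 < c 2 ∧ c 3 < 0) ∧ ∑ i, c i = 0 ∧
      ∑ i, c i • v i = 0 by
    obtain ⟨c, hc, hs, hcv⟩ := H
    refine ⟨![c 0, -c 1, c 2, -c 3], ?_, ?_, fun u => ?_⟩
    · intro i
      fin_cases i
      · exact hc.1
      · exact neg_pos.2 hc.2.1
      · exact hc.2.2.1
      · exact neg_pos.2 hc.2.2.2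
    · rw [Fin.sum_univ_four] at hs
      simp
      linarith
    · have h := congrArg u.linear hcv
      rw [Fin.sum_univ_four] at h hs
      simp only [map_add, map_smul, map_zero, smul_eq_mul] at h
      simp only [affine_eq u (v _), Matrix.cons_val]
      linear_combination h + u 0 * hs
  let χ : ℝ × E3 →ₗ[ℝ] ℝ := φ ∘ₗ LinearMap.snd ℝ ℝ E3 - r • LinearMap.fst ℝ ℝ E3
  have hχ : χ ≠ 0 := by
    intro h
    apply hφ
    ext x
    have := LinearMap.congr_fun h (0, x)
    simpa [χ] using this
  have hrank : Module.finrank ℝ (LinearMap.ker χ) = 3 := by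
    have h1 := LinearMap.finrank_range_add_finrank_ker χ
    rw [LinearMap.range_eq_top.2 (LinearMap.surjective hχ)] at h1
    simp at h1
    omega
  let F : (Fin 4 → ℝ) →ₗ[ℝ] ℝ × E3 := ∑ i, (LinearMap.proj i).smulRight ((1 : ℝ), v i)
  have hF : ∀ c, F c = (∑ i, c i, ∑ i, c i • v i) := by
    intro c
    refine Prod.ext ?_ ?_
    · simp [F, Prod.fst_sum]
    · simp [F, Prod.snd_sum]
  have hmem : ∀ c, F c ∈ LinearMap.ker χ := by
    intro c
    rw [LinearMap.mem_ker, hF]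
    simp [χ, hv, Finset.mul_sum, mul_comm]
  have hbot := LinearMap.ker_ne_bot_of_finrank_lt (f := F.codRestrict _ hmem)
    (by rw [hrank]; simp)
  obtain ⟨c, hc, hc0⟩ := (Submodule.ne_bot_iff _).1 hbot
  have hFc : F c = 0 := by
    rw [LinearMap.mem_ker] at hc
    exact congrArg Subtype.val hc
  rw [hF] at hFc
  have hs : ∑ i, c i = 0 := congrArg Prod.fst hFc
  have hcv : ∑ i, c i • v i = 0 := congrArg Prod.snd hFc
  have hrel : ∀ i, ∑ k, c k * (ψ i (v k) - t i) = 0 := by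
    intro i
    have h := congrArg (ψ i) hcv
    simp only [map_sum, map_smul, map_zero, smul_eq_mul] at h
    simp only [mul_sub, Finset.sum_sub_distrib, h, ← Finset.sum_mul, hs, zero_mul, sub_zero]
  have hopp : ∀ i, (c (i + 2) = 0 ↔ c (i + 3) = 0) ∧ (0 < c (i + 2) ↔ c (i + 3) < 0) ∧
      (c (i + 2) < 0 ↔ 0 < c (i + 3)) := by
    intro i
    refine opposite_signs (sub_neg.2 (h2 i)) (sub_neg.2 (h3 i)) ?_
    have h := hrel i
    rw [← Equiv.sum_comp (Equiv.addLeft i), Fin.sum_univ_four] at h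
    simpa [h0, h1] using h
  have o0 := hopp 0
  have o1 := hopp 1
  have o2 := hopp 2
  have o3 := hopp 3
  norm_num at o0 o1 o2 o3
  simp only [show (1 : Fin 4) + 2 = 3 from rfl, show (1 : Fin 4) + 3 = 0 from rfl,
    show (2 : Fin 4) + 2 = 0 from rfl, show (2 : Fin 4) + 3 = 1 from rfl,
    show (3 : Fin 4) + 2 = 1 from rfl, show (3 : Fin 4) + 3 = 2 from rfl] at o0 o1 o2 o3
  rcases lt_trichotomy (c 0) 0 with h | h | h
  · refine ⟨-c, ?_, by simp [hs], by simp [hcv]⟩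
    have g1 := o2.2.2.1 h
    have g2 := o3.2.1.1 g1
    have g3 := o0.2.2.1 g2
    simp only [Pi.neg_apply]
    exact ⟨by linarith, by linarith, by linarith, by linarith⟩
  · exfalso
    apply hc0
    have g1 := o2.1.1 h
    have g2 := o3.1.1 g1
    have g3 := o0.1.1 g2
    funext i
    fin_cases i <;> assumption
  · refine ⟨c, ?_, hs, hcv⟩
    have g1 := o2.2.1.1 h
    have g2 := o3.2.2.1 g1
    have g3 := o0.2.1.1 g2
    exact ⟨h, g1, g2, g3⟩

/-! ### The corners of cells and faces -/

theorem mem_cell_corners {c : Cell N} {p : Fin 3 → ℕ} :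
    p ∈ c.corners ↔ ∀ k, p k = c.1 k ∨ p k = c.1 k + 1 := by
  simp [Cell.corners, Fintype.mem_piFinset]

theorem mem_lower_corners {c : Cell N} {j : Fin 3} {p : Fin 3 → ℕ} :
    p ∈ (c.lower j).corners ↔ p ∈ c.corners ∧ p j = c.1 j := by
  simp only [Face.corners, Cell.lower, Fintype.mem_piFinset, mem_cell_corners]
  constructor
  · intro h
    refine ⟨fun k => ?_, by simpa using h j⟩
    have := h k
    by_cases hk : k = j
    · subst hk; simp at this; exact Or.inl this
    · simpa [hk] using this
  · rintro ⟨h, h'⟩ k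
    by_cases hk : k = j
    · subst hk; simpa using h'
    · simpa [hk] using h k

theorem mem_upper_corners {c : Cell N} {j : Fin 3} {p : Fin 3 → ℕ} :
    p ∈ (c.upper j).corners ↔ p ∈ c.corners ∧ p j = c.1 j + 1 := by
  simp only [Face.corners, Cell.upper, Fintype.mem_piFinset, mem_cell_corners]
  constructor
  · intro h
    refine ⟨fun k => ?_, by simpa using h j⟩
    have := h k
    by_cases hk : k = j
    · subst hk; simp at this; exact Or.inr this
    · simpa [hk] using this
  · rintro ⟨h, h'⟩ k
    by_cases hk : k = j
    · subst hk; simpa using h'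
    · simpa [hk] using h k

theorem sum_piFinset_three {M : Type*} [AddCommMonoid M] (s : Fin 3 → Finset ℕ)
    (g : (Fin 3 → ℕ) → M) :
    ∑ p ∈ Fintype.piFinset s, g p = ∑ x ∈ s 0, ∑ y ∈ s 1, ∑ z ∈ s 2, g ![x, y, z] := by
  simp_rw [← Finset.sum_product']
  have hcons : ∀ p : Fin 3 → ℕ, ![p 0, p 1, p 2] = p := by
    intro p; funext k; fin_cases k <;> rfl
  refine Finset.sum_nbij' (fun p => (p 0, p 1, p 2)) (fun x => ![x.1, x.2.1, x.2.2]) ?_ ?_ ?_ ?_ ?_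
  · intro p hp
    simp only [Fintype.mem_piFinset] at hp
    simp [hp]
  · rintro ⟨x, y, z⟩ h
    simp only [Finset.mem_product] at h
    simp only [Fintype.mem_piFinset]
    intro k
    fin_cases k
    exacts [h.1, h.2.1, h.2.2]
  · intro p _
    exact hcons p
  · intro x _
    simp
  · intro p _
    dsimp only
    rw [hcons]

namespace HexMesh

variable {ℓ : Fin 3 → ℝ} (T : HexMesh ℓ N)

/-- The supporting planes of a cell. The face in the `j`-th direction is the one with
`j`-th label `t`. -/
theorem exists_support (c : Cell N) (j : Fin 3) {t : ℕ} (ht : t = c.1 j ∨ t = c.1 j + 1) :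
    ∃ (φ : E3 →ₗ[ℝ] ℝ) (r : ℝ), φ ≠ 0 ∧ ∀ p ∈ c.corners,
      (p j = t → φ (T.node p) = r) ∧ (p j ≠ t → φ (T.node p) < r) := by
  have H : ∃ (φ : E3 →ₗ[ℝ] ℝ) (r : ℝ), ∀ p ∈ c.corners,
      (p j = t → φ (T.node p) = r) ∧ (p j ≠ t → φ (T.node p) < r) := by
    rcases ht with rfl | rfl
    · obtain ⟨φ, r, h⟩ := T.supporting c j _ (Or.inl rfl)
      refine ⟨φ, r, fun p hp => ⟨fun h' => (h p hp).1 (mem_lower_corners.2 ⟨hp, h'⟩),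
        fun h' => (h p hp).2 fun h'' => h' (mem_lower_corners.1 h'').2⟩⟩
    · obtain ⟨φ, r, h⟩ := T.supporting c j _ (Or.inr rfl)
      refine ⟨φ, r, fun p hp => ⟨fun h' => (h p hp).1 (mem_upper_corners.2 ⟨hp, h'⟩),
        fun h' => (h p hp).2 fun h'' => h' (mem_upper_corners.1 h'').2⟩⟩
  obtain ⟨φ, r, h⟩ := H
  refine ⟨φ, r, ?_, h⟩
  rintro rfl
  have h1 : c.1 ∈ c.corners := mem_cell_corners.2 fun k => Or.inl rfl
  have h2 : c.1 + Pi.single j 1 ∈ c.corners := mem_cell_corners.2 fun k => by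
    by_cases hk : k = j
    · subst hk; simp
    · simp [hk]
  have g1 := h _ h1
  have g2 := h _ h2
  simp only [LinearMap.zero_apply, Pi.add_apply, Pi.single_eq_same] at g1 g2
  rcases ht with rfl | rfl
  · have := g1.1 rfl
    have := g2.2 (by simp)
    linarith
  · have := g1.2 (by simp)
    have := g2.1 rfl
    linarith

/-- The corner of a cell with the given offsets. -/
def cornerNode (c : Cell N) (i j k : ℕ) : E3 := T.node ![c.1 0 + i, c.1 1 + j, c.1 2 + k]

theorem corner_mem (c : Cell N) {i j k : ℕ} (hi : i < 2) (hj : j < 2) (hk : k < 2) :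
    ![c.1 0 + i, c.1 1 + j, c.1 2 + k] ∈ c.corners := by
  rw [mem_cell_corners]
  intro l
  fin_cases l <;> simp <;> omega

theorem affine_quarter (u : P1) (a b c d : E3) :
    u ((1 / 4 : ℝ) • (a + b + c + d)) = (u a + u b + u c + u d) / 4 := by
  rw [affine_eq u (_ • _), affine_eq u a, affine_eq u b, affine_eq u c, affine_eq u d]
  simp only [map_smul, map_add, smul_eq_mul]
  ring

theorem quadBound_of_corners (c : Cell N) (j k l : Fin 3) (q : Fin 4 → Fin 3 → ℕ) {t : ℕ}
    (ht : t < 2)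
    (hq : ∀ i, q i ∈ c.corners) (hj : ∀ i, q i j = c.1 j + t)
    (hk : ∀ i, q i k = c.1 k + ![0, 1, 1, 0] i) (hl : ∀ i, q i l = c.1 l + ![0, 0, 1, 1] i)
    (u : P1) (hu : u (T.node (q 0)) + u (T.node (q 1)) + u (T.node (q 3)) +
      u (T.node (q 2)) = 0) :
    QuadBound (u (T.node (q 0))) (u (T.node (q 1))) (u (T.node (q 3))) (u (T.node (q 2))) := by
  obtain ⟨φ, r, hφ, h⟩ := T.exists_support c j (t := c.1 j + t) (by omega)
  obtain ⟨φl, rl, -, gl⟩ := T.exists_support c l (t := c.1 l) (Or.inl rfl)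
  obtain ⟨φl', rl', -, gl'⟩ := T.exists_support c l (t := c.1 l + 1) (Or.inr rfl)
  obtain ⟨φk, rk, -, gk⟩ := T.exists_support c k (t := c.1 k) (Or.inl rfl)
  obtain ⟨φk', rk', -, gk'⟩ := T.exists_support c k (t := c.1 k + 1) (Or.inr rfl)
  obtain ⟨a, ha, ha1, ha2⟩ := exists_quad_relation (v := fun i => T.node (q i)) hφ
    (fun i => (h _ (hq i)).1 (hj i)) (ψ := ![φl, φk', φl', φk]) (t := ![rl, rk', rl', rk])
    (by
      intro i
      fin_cases i
      · exact (gl _ (hq _)).1 (by simp [hl])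
      · exact (gk' _ (hq _)).1 (by simp [hk])
      · exact (gl' _ (hq _)).1 (by simp [hl])
      · exact (gk _ (hq _)).1 (by simp [hk]))
    (by
      intro i
      fin_cases i
      · exact (gl _ (hq _)).1 (by simp [hl])
      · exact (gk' _ (hq _)).1 (by simp [hk])
      · exact (gl' _ (hq _)).1 (by simp [hl])
      · exact (gk _ (hq _)).1 (by simp [hk]))
    (by
      intro i
      fin_cases i
      · exact (gl _ (hq _)).2 (by simp [hl])
      · exact (gk' _ (hq _)).2 (by simp [hk])
      · exact (gl' _ (hq _)).2 (by simp [hl])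
      · exact (gk _ (hq _)).2 (by simp [hk]))
    (by
      intro i
      fin_cases i
      · exact (gl _ (hq _)).2 (by simp [hl])
      · exact (gk' _ (hq _)).2 (by simp [hk])
      · exact (gl' _ (hq _)).2 (by simp [hl])
      · exact (gk _ (hq _)).2 (by simp [hk]))
  exact quadBound (ha 0) (ha 1) (ha 3) (ha 2) ha1 (ha2 u) hu

theorem midpoint_lower (c : Cell N) (u : P1) :
    (u (T.midpoint (c.lower 0)) = (u (T.cornerNode c 0 0 0) + u (T.cornerNode c 0 1 0) +
      u (T.cornerNode c 0 0 1) + u (T.cornerNode c 0 1 1)) / 4) ∧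
    (u (T.midpoint (c.lower 1)) = (u (T.cornerNode c 0 0 0) + u (T.cornerNode c 1 0 0) +
      u (T.cornerNode c 0 0 1) + u (T.cornerNode c 1 0 1)) / 4) ∧
    (u (T.midpoint (c.lower 2)) = (u (T.cornerNode c 0 0 0) + u (T.cornerNode c 1 0 0) +
      u (T.cornerNode c 0 1 0) + u (T.cornerNode c 1 1 0)) / 4) := by
  refine ⟨?_, ?_, ?_⟩ <;> rw [← affine_quarter, midpoint, Face.corners, sum_piFinset_three] <;>
    congr 2 <;> simp [Cell.lower, cornerNode] <;> abel

theorem midpoint_upper (c : Cell N) (u : P1) :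
    (u (T.midpoint (c.upper 0)) = (u (T.cornerNode c 1 0 0) + u (T.cornerNode c 1 1 0) +
      u (T.cornerNode c 1 0 1) + u (T.cornerNode c 1 1 1)) / 4) ∧
    (u (T.midpoint (c.upper 1)) = (u (T.cornerNode c 0 1 0) + u (T.cornerNode c 1 1 0) +
      u (T.cornerNode c 0 1 1) + u (T.cornerNode c 1 1 1)) / 4) ∧
    (u (T.midpoint (c.upper 2)) = (u (T.cornerNode c 0 0 1) + u (T.cornerNode c 1 0 1) +
      u (T.cornerNode c 0 1 1) + u (T.cornerNode c 1 1 1)) / 4) := by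
  refine ⟨?_, ?_, ?_⟩ <;> rw [← affine_quarter, midpoint, Face.corners, sum_piFinset_three] <;>
    congr 2 <;> simp [Cell.upper, cornerNode] <;> abel

theorem opposite_sum (c : Cell N) (u : P1) (j : Fin 3) :
    u (T.midpoint (c.lower j)) + u (T.midpoint (c.upper j)) =
      u (T.midpoint (c.lower 0)) + u (T.midpoint (c.upper 0)) := by
  obtain ⟨l0, l1, l2⟩ := T.midpoint_lower c u
  obtain ⟨u0, u1, u2⟩ := T.midpoint_upper c u
  fin_cases j
  · rfl
  · change u (T.midpoint (c.lower 1)) + u (T.midpoint (c.upper 1)) = _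
    rw [l0, l1, u0, u1]; ring
  · change u (T.midpoint (c.lower 2)) + u (T.midpoint (c.upper 2)) = _
    rw [l0, l2, u0, u2]; ring

/-- An affine function that vanishes at the midpoints of all faces of a cell vanishes at
the corners of the cell. -/
theorem eq_zero_at_corners (c : Cell N) (u : P1) (hl : ∀ j, u (T.midpoint (c.lower j)) = 0)
    (hu : ∀ j, u (T.midpoint (c.upper j)) = 0) :
    ∀ i < 2, ∀ j < 2, ∀ k < 2, u (T.cornerNode c i j k) = 0 := by
  obtain ⟨l0, l1, l2⟩ := T.midpoint_lower c u
  obtain ⟨u0, u1, u2⟩ := T.midpoint_upper c u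
  rw [hl] at l0 l1 l2
  rw [hu] at u0 u1 u2
  have hz : ZeroFaceSums fun i j k => u (T.cornerNode c i j k) := by
    constructor <;> intro i hi <;> interval_cases i <;> linarith
  refine hz.eq_zero (fun i hi => ?_) (fun i hi => ?_) (fun i hi => ?_)
  · refine T.quadBound_of_corners c 0 1 2
      (fun n => ![c.1 0 + i, c.1 1 + ![0, 1, 1, 0] n, c.1 2 + ![0, 0, 1, 1] n]) hi ?_
      (fun n => rfl) (fun n => rfl) (fun n => rfl) u (hz.x i hi)
    intro n
    fin_cases n <;> exact corner_mem c hi (by simp) (by simp)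
  · refine T.quadBound_of_corners c 1 0 2
      (fun n => ![c.1 0 + ![0, 1, 1, 0] n, c.1 1 + i, c.1 2 + ![0, 0, 1, 1] n]) hi ?_
      (fun n => rfl) (fun n => rfl) (fun n => rfl) u (hz.y i hi)
    intro n
    fin_cases n <;> exact corner_mem c (by simp) hi (by simp)
  · refine T.quadBound_of_corners c 2 0 1
      (fun n => ![c.1 0 + ![0, 1, 1, 0] n, c.1 1 + ![0, 0, 1, 1] n, c.1 2 + i]) hi ?_
      (fun n => rfl) (fun n => rfl) (fun n => rfl) u (hz.z i hi)
    intro n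
    fin_cases n <;> exact corner_mem c (by simp) (by simp) hi

end HexMesh

/-! ### Nondegeneracy of cells and faces -/

theorem linearIndependent_of_dual {ι E : Type*} [Fintype ι] [AddCommGroup E] [Module ℝ E]
    {d : ι → E} (φ : ι → E →ₗ[ℝ] ℝ) (h0 : ∀ i k, k ≠ i → φ i (d k) = 0)
    (h1 : ∀ i, φ i (d i) ≠ 0) : LinearIndependent ℝ d := by
  rw [Fintype.linearIndependent_iff]
  intro g hg i
  have h := congrArg (φ i) hg
  simp only [map_sum, map_smul, map_zero, smul_eq_mul] at h
  rw [Finset.sum_eq_single i (fun k _ hk => by rw [h0 i k hk, mul_zero]) (by simp)] at h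
  exact (mul_eq_zero.1 h).resolve_right (h1 i)

theorem interior_convexHull_nonempty_of_edges {ι E : Type*} [NormedAddCommGroup E]
    [NormedSpace ℝ E] [FiniteDimensional ℝ E] {S : Set E} {x : E} (hx : x ∈ S) {d : ι → E}
    (hd : ∀ i, x + d i ∈ S) (hs : Submodule.span ℝ (Set.range d) = ⊤) :
    (interior (convexHull ℝ S)).Nonempty := by
  rw [interior_convexHull_nonempty_iff_affineSpan_eq_top,
    AffineSubspace.affineSpan_eq_top_iff_vectorSpan_eq_top_of_nonempty ℝ E E ⟨x, hx⟩, eq_top_iff,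
    ← hs, Submodule.span_le]
  rintro _ ⟨i, rfl⟩
  have := vsub_mem_vectorSpan ℝ (hd i) hx
  simpa using this

theorem add_single_mem_corners {c : Cell N} {p : Fin 3 → ℕ} (hp : p ∈ c.corners) {k : Fin 3}
    (hk : p k = c.1 k) : p + Pi.single k 1 ∈ c.corners := by
  rw [mem_cell_corners] at hp ⊢
  intro l
  by_cases hl : l = k
  · subst hl; simp [hk]
  · simpa [hl] using hp l

theorem self_mem_corners (c : Cell N) : c.1 ∈ c.corners :=
  mem_cell_corners.2 fun _ => Or.inl rfl

theorem exists_cell_of_face (hN : ∀ k, 0 < N k) (f : Face N) : ∃ (c : Cell N) (j : Fin 3) (t : ℕ),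
    (t = c.1 j ∨ t = c.1 j + 1) ∧ ∀ p, p ∈ f.corners ↔ p ∈ c.corners ∧ p j = t := by
  obtain ⟨⟨j, p⟩, h1, h2⟩ := f
  dsimp only at h1 h2
  rcases h1.lt_or_eq with h | h
  · let c : Cell N := ⟨p, fun k => by
      by_cases hk : k = j
      · subst hk; exact h
      · exact h2 k hk⟩
    refine ⟨c, j, c.1 j, Or.inl rfl, fun q => ?_⟩
    rw [← mem_lower_corners]
    rfl
  · have hN := hN j
    let c : Cell N := ⟨Function.update p j (p j - 1), fun k => by
      by_cases hk : k = j
      · subst hk; simp; omega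
      · simpa [hk] using h2 k hk⟩
    have hc : c.1 j + 1 = p j := by simp [c]; omega
    refine ⟨c, j, c.1 j + 1, Or.inr rfl, fun q => ?_⟩
    rw [← mem_upper_corners]
    have : (⟨(j, p), h1, h2⟩ : Face N) = c.upper j := by
      refine Subtype.ext (Prod.ext rfl (funext fun k => ?_))
      by_cases hk : k = j
      · subst hk; simpa [Cell.upper] using hc.symm
      · simp [Cell.upper, c, hk]
    rw [this]

theorem card_face_corners (f : Face N) : f.corners.card = 4 := by
  obtain ⟨⟨j, p⟩, h⟩ := f
  rw [Face.corners, Fintype.card_piFinset, Fin.prod_univ_three]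
  fin_cases j <;> simp

namespace HexMesh

variable {ℓ : Fin 3 → ℝ} (T : HexMesh ℓ N)

/-- Dual functionals of the edges of a cell at a corner. -/
theorem exists_dual (c : Cell N) (k : Fin 3) : ∃ φ : E3 →ₗ[ℝ] ℝ, ∀ p ∈ c.corners, p k = c.1 k →
    φ (T.node (p + Pi.single k 1) - T.node p) ≠ 0 ∧ ∀ l, l ≠ k → p l = c.1 l →
      φ (T.node (p + Pi.single l 1) - T.node p) = 0 := by
  obtain ⟨φ, r, -, h⟩ := T.exists_support c k (t := c.1 k) (Or.inl rfl)
  refine ⟨φ, fun p hp hk => ⟨?_, fun l hl hpl => ?_⟩⟩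
  · rw [map_sub, (h p hp).1 hk]
    have := (h _ (add_single_mem_corners hp hk)).2 (by simp [hk])
    linarith
  · rw [map_sub, (h p hp).1 hk,
      (h _ (add_single_mem_corners hp hpl)).1 (by simp [hk, hl.symm]), sub_self]

theorem span_edges (c : Cell N) : Submodule.span ℝ
    (Set.range fun k => T.node (c.1 + Pi.single k 1) - T.node c.1) = ⊤ := by
  choose φ hφ using T.exists_dual c
  have h : LinearIndependent ℝ fun k => T.node (c.1 + Pi.single k 1) - T.node c.1 :=
    linearIndependent_of_dual φ
      (fun i k hk => (hφ i _ (self_mem_corners c) rfl).2 k hk rfl)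
      (fun i => (hφ i _ (self_mem_corners c) rfl).1)
  exact h.span_eq_top_of_card_eq_finrank' (by simp)

theorem interior_cell_nonempty (c : Cell N) : (interior (T.cell c)).Nonempty := by
  refine interior_convexHull_nonempty_of_edges (x := T.node c.1)
    ⟨_, self_mem_corners c, rfl⟩ (fun k => ?_) (T.span_edges c)
  rw [add_sub_cancel]
  exact ⟨_, add_single_mem_corners (self_mem_corners c) rfl, rfl⟩

theorem eq_zero_of_corners (c : Cell N) (u : P1) (h : ∀ p ∈ c.corners, u (T.node p) = 0) :
    u = 0 := by
  have hlin : u.linear = 0 := by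
    refine LinearMap.ext_on_range (T.span_edges c) fun k => ?_
    have h1 := h _ (self_mem_corners c)
    have h2 := h _ (add_single_mem_corners (self_mem_corners c) (k := k) rfl)
    rw [affine_eq] at h1 h2
    rw [map_sub, LinearMap.zero_apply]
    linarith
  have h0 : u 0 = 0 := by
    have h1 := h _ (self_mem_corners c)
    rwa [affine_eq, hlin, LinearMap.zero_apply, zero_add] at h1
  ext x
  rw [affine_eq, hlin, h0]
  simp

theorem eq_zero_of_midpoints (c : Cell N) (u : P1) (hl : ∀ j, u (T.midpoint (c.lower j)) = 0)
    (hu : ∀ j, u (T.midpoint (c.upper j)) = 0) : u = 0 := by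
  refine T.eq_zero_of_corners c u fun p hp => ?_
  rw [mem_cell_corners] at hp
  have h := T.eq_zero_at_corners c u hl hu (p 0 - c.1 0) (by have := hp 0; omega)
    (p 1 - c.1 1) (by have := hp 1; omega) (p 2 - c.1 2) (by have := hp 2; omega)
  rw [cornerNode] at h
  convert h using 3
  funext k
  fin_cases k
  · have := hp 0; simp; omega
  · have := hp 1; simp; omega
  · have := hp 2; simp; omega

/-! ### Face averages on parallelograms -/

theorem area_face_ne_zero (f : Face N) : (μHE[2] : Measure E3) (T.face f) ≠ 0 := by
  obtain ⟨c, j, t, ht, hf⟩ := exists_cell_of_face T.count_pos f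
  choose φ hφ using T.exists_dual c
  let p := Function.update c.1 j t
  have hp : p ∈ c.corners := by
    rw [mem_cell_corners]
    intro k
    by_cases hk : k = j
    · subst hk; simpa [p] using ht
    · simp [p, hk]
  have hpk : ∀ k, k ≠ j → p k = c.1 k := fun k hk => by simp [p, hk]
  have hpf : p ∈ f.corners := (hf p).2 ⟨hp, by simp [p]⟩
  have hpf' : ∀ k, k ≠ j → p + Pi.single k 1 ∈ f.corners := fun k hk =>
    (hf _).2 ⟨add_single_mem_corners hp (hpk k hk), by simp [p, hk.symm]⟩
  let π : E3 →L[ℝ] EuclideanSpace ℝ {k : Fin 3 // k ≠ j} := LinearMap.toContinuousLinearMap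
    ((WithLp.linearEquiv 2 ℝ ({k : Fin 3 // k ≠ j} → ℝ)).symm.toLinearMap ∘ₗ
      LinearMap.pi fun k => φ k)
  have hπ : ∀ x k, π x k = φ k x := fun _ _ => rfl
  have hcard : Fintype.card {k : Fin 3 // k ≠ j} = 2 := by
    fin_cases j <;> rfl
  have hfr : Module.finrank ℝ (EuclideanSpace ℝ {k : Fin 3 // k ≠ j}) = 2 := by
    rw [finrank_euclideanSpace, hcard]
  have hlin : LinearIndependent ℝ fun k : {k : Fin 3 // k ≠ j} =>
      π (T.node (p + Pi.single k.1 1) - T.node p) := by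
    refine linearIndependent_of_dual (fun k => (EuclideanSpace.proj k).toLinearMap) ?_ ?_
    · intro i k hk
      exact (hφ i p hp (hpk i i.2)).2 k (fun h => hk (Subtype.ext h)) (hpk k k.2)
    · intro i
      exact (hφ i p hp (hpk i i.2)).1
  have hint : (interior (π '' T.face f)).Nonempty := by
    rw [face, ← ContinuousLinearMap.coe_coe, LinearMap.image_convexHull]
    refine interior_convexHull_nonempty_of_edges (x := π (T.node p))
      ⟨_, ⟨p, hpf, rfl⟩, rfl⟩ (fun k => ?_)
      (hlin.span_eq_top_of_card_eq_finrank' (by rw [hcard, hfr]))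
    rw [← map_add, add_sub_cancel]
    exact ⟨_, ⟨_, hpf' k k.2, rfl⟩, rfl⟩
  have hpos : (μHE[2] : Measure (EuclideanSpace ℝ {k : Fin 3 // k ≠ j})) (π '' T.face f) ≠ 0 := by
    have h := InnerProductSpace.euclideanHausdorffMeasure_eq_volume
      (V := EuclideanSpace ℝ {k : Fin 3 // k ≠ j})
    rw [hfr] at h
    rw [h]
    exact (Measure.measure_pos_of_nonempty_interior _ hint).ne'
  intro h0
  apply hpos
  rw [Measure.euclideanHausdorffMeasure_def] at h0 ⊢
  simp only [Measure.smul_apply, smul_eq_zero,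
    Measure.addHaarScalarFactor_volume_hausdorffMeasure_ne_zero, false_or] at h0 ⊢
  have h := π.lipschitz.hausdorffMeasure_image_le (d := (2 : ℕ)) (by norm_num) (T.face f)
  rwa [h0, mul_zero, nonpos_iff_eq_zero] at h

theorem exists_reflection (hT : T.IsParallelepiped) (f : Face N) :
    ∃ (ρ : (Fin 3 → ℕ) → Fin 3 → ℕ), (∀ p ∈ f.corners, ρ p ∈ f.corners) ∧
      (∀ p ∈ f.corners, ρ (ρ p) = p) ∧
      ∀ p ∈ f.corners, T.node (ρ p) = (2 : ℝ) • T.midpoint f - T.node p := by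
  obtain ⟨c, j, t, ht, hf⟩ := exists_cell_of_face T.count_pos f
  let ρ : (Fin 3 → ℕ) → Fin 3 → ℕ := fun p k => if k = j then t else 2 * c.1 k + 1 - p k
  have hρ : ∀ p ∈ f.corners, ρ p ∈ f.corners := by
    intro p hp
    rw [hf, mem_cell_corners] at hp ⊢
    refine ⟨fun k => ?_, by simp [ρ]⟩
    by_cases hk : k = j
    · subst hk; simpa [ρ] using ht
    · have := hp.1 k
      simp only [ρ, hk, if_false]
      omega
  have hρρ : ∀ p ∈ f.corners, ρ (ρ p) = p := by
    intro p hp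
    rw [hf, mem_cell_corners] at hp
    funext k
    by_cases hk : k = j
    · subst hk; simp [ρ, hp.2]
    · have := hp.1 k
      simp only [ρ, hk, if_false]
      omega
  have hsum : ∀ p ∈ f.corners, ∀ q ∈ f.corners,
      T.node p + T.node (ρ p) = T.node q + T.node (ρ q) := by
    intro p hp q hq
    have hp' := hρ p hp
    have hq' := hρ q hq
    rw [hf] at hp hq hp' hq'
    refine hT c p hp.1 _ hp'.1 q hq.1 _ hq'.1 (funext fun k => ?_)
    have h1 := mem_cell_corners.1 hp.1 k
    have h2 := mem_cell_corners.1 hq.1 k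
    by_cases hk : k = j
    · subst hk; simp [ρ, hp.2, hq.2]
    · simp only [ρ, hk, if_false, Pi.add_apply]
      omega
  refine ⟨ρ, hρ, hρρ, fun p hp => ?_⟩
  have h1 : ∑ q ∈ f.corners, T.node (ρ q) = ∑ q ∈ f.corners, T.node q :=
    Finset.sum_nbij' ρ ρ hρ hρ hρρ hρρ fun _ _ => rfl
  have h2 : ∑ q ∈ f.corners, (T.node q + T.node (ρ q)) = 4 • (T.node p + T.node (ρ p)) := by
    rw [Finset.sum_congr rfl fun q hq => hsum q hq p hp, Finset.sum_const, card_face_corners]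
  rw [Finset.sum_add_distrib, h1] at h2
  have h3 : ∑ q ∈ f.corners, T.node q = (2 : ℝ) • (T.node p + T.node (ρ p)) := by
    have h4 : (2 : ℝ) • ∑ q ∈ f.corners, T.node q =
        (2 : ℝ) • ((2 : ℝ) • (T.node p + T.node (ρ p))) := by
      rw [two_smul, h2, smul_smul, ← Nat.cast_smul_eq_nsmul ℝ]
      norm_num
    exact smul_right_injective E3 (two_ne_zero' ℝ) h4
  rw [midpoint, h3, smul_smul, smul_smul]
  norm_num

theorem faceAverage_eq_midpointValue (hT : T.IsParallelepiped) :
    T.faceAverage = T.midpointValue := by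
  funext f
  ext u
  obtain ⟨ρ, hρ, hρρ, hnode⟩ := T.exists_reflection hT f
  let m := T.midpoint f
  let e : E3 ≃ᵢ E3 := IsometryEquiv.subLeft ((2 : ℝ) • m)
  have he : ∀ x, e x = (2 : ℝ) • m - x := fun _ => rfl
  have hsub : ∀ x ∈ T.face f, e x ∈ T.face f := by
    have hlin : T.face f ⊆ (fun x => (2 : ℝ) • m - x) ⁻¹' T.face f := by
      refine convexHull_min ?_ ?_
      · rintro _ ⟨p, hp, rfl⟩
        refine subset_convexHull ℝ _ ⟨ρ p, hρ p hp, hnode p hp⟩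
      · exact (convex_convexHull ℝ _).affine_preimage
          (AffineMap.const ℝ E3 ((2 : ℝ) • m) - AffineMap.id ℝ E3)
    exact hlin
  have hpre : e ⁻¹' T.face f = T.face f := by
    refine Set.Subset.antisymm (fun x hx => ?_) hsub
    have h := hsub _ hx
    rwa [he, he, sub_sub_cancel] at h
  have hint : ∫ x in T.face f, u (e x) ∂(μHE[2] : Measure E3) =
      ∫ x in T.face f, u x ∂(μHE[2] : Measure E3) := by
    have h := (e.measurePreserving_euclideanHausdorffMeasure 2).setIntegral_preimage_emb
      e.toHomeomorph.measurableEmbedding (fun x => u x) (T.face f)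
    rwa [hpre] at h
  have hsymm : ∀ x, u (e x) = 2 * u m - u x := by
    intro x
    rw [he, affine_eq, affine_eq u m, affine_eq u x, map_sub, map_smul, smul_eq_mul]
    ring
  simp_rw [hsymm] at hint
  have hfin := (T.area_face_lt_top f).ne
  have hconst : IntegrableOn (fun _ : E3 => 2 * u m) (T.face f) (μHE[2] : Measure E3) :=
    integrableOn_const hfin
  rw [integral_sub hconst (T.integrableOn_face f u), setIntegral_const, smul_eq_mul] at hint
  change ⨍ x in T.face f, u x ∂(μHE[2] : Measure E3) = u m
  have hpos : (μHE[2] : Measure E3).real (T.face f) ≠ 0 :=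
    ENNReal.toReal_ne_zero.2 ⟨T.area_face_ne_zero f, hfin⟩
  rw [setAverage_eq, smul_eq_mul, inv_mul_eq_iff_eq_mul₀ hpos]
  linarith

end HexMesh

theorem finrank_P1 : Module.finrank ℝ P1 = 4 := by
  rw [AffineMap.finrank_eq]
  simp

theorem next_upper_eq_lower {c c' : Cell N} {j : Fin 3} (h : c.Next j c') :
    c.upper j = c'.lower j :=
  Subtype.ext (Prod.ext rfl h.symm)

theorem exists_prev {c : Cell N} {j : Fin 3} (h : c.1 j ≠ 0) :
    ∃ c' : Cell N, c'.Next j c ∧ c'.1 j + 1 = c.1 j := by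
  refine ⟨⟨Function.update c.1 j (c.1 j - 1), update_lt c j (by have := c.2 j; omega)⟩, ?_, ?_⟩
  · funext k
    by_cases hk : k = j
    · subst hk; simp; omega
    · simp [hk]
  · simp; omega

namespace HexMesh

variable {ℓ : Fin 3 → ℝ} (T : HexMesh ℓ N)

/-! ### Piecewise linear functions in coordinates -/

/-- Affine functions on a cell in terms of the midpoint values. -/
def localMap (c : Cell N) : P1 →ₗ[ℝ] ℝ × (Fin 3 → ℝ) :=
  (T.midpointValue (c.lower 0) + T.midpointValue (c.upper 0)).prod
    (LinearMap.pi fun j => T.midpointValue (c.lower j))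

theorem localMap_fst (c : Cell N) (u : P1) (j : Fin 3) :
    (T.localMap c u).1 = T.midpointValue (c.lower j) u + T.midpointValue (c.upper j) u :=
  (T.opposite_sum c u j).symm

theorem localMap_snd (c : Cell N) (u : P1) (j : Fin 3) :
    (T.localMap c u).2 j = T.midpointValue (c.lower j) u := rfl

theorem localMap_injective (c : Cell N) : Function.Injective (T.localMap c) := by
  rw [← LinearMap.ker_eq_bot, LinearMap.ker_eq_bot']
  intro u hu
  have hl : ∀ j, u (T.midpoint (c.lower j)) = 0 := fun j => by
    have := T.localMap_snd c u j
    rw [hu] at this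
    exact this.symm
  refine T.eq_zero_of_midpoints c u hl fun j => ?_
  have := T.localMap_fst c u j
  rw [hu] at this
  have h2 : (0 : ℝ) = u (T.midpoint (c.lower j)) + u (T.midpoint (c.upper j)) := this
  rw [hl, zero_add] at h2
  exact h2.symm

/-- Affine functions on a cell are determined by the midpoint values. -/
def localEquiv (c : Cell N) : P1 ≃ₗ[ℝ] ℝ × (Fin 3 → ℝ) :=
  haveI : FiniteDimensional ℝ P1 := Module.finite_of_finrank_pos (by rw [finrank_P1]; norm_num)
  LinearMap.linearEquivOfInjective (T.localMap c) (T.localMap_injective c)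
    (by rw [finrank_P1]; simp)

/-- The piecewise linear function with given coordinates. -/
def toPoly : Coord N →ₗ[ℝ] (Cell N → P1) :=
  LinearMap.pi fun c => (T.localEquiv c).symm.toLinearMap ∘ₗ
    (LinearMap.proj c ∘ₗ LinearMap.fst ℝ (Cell N → ℝ) (OppPair N → ℝ)).prod
      (LinearMap.pi fun j => gridVal c j)

theorem localMap_toPoly (c : Cell N) (d : Coord N) :
    T.localMap c (T.toPoly d c) = (d.1 c, fun j => gridVal c j d) :=
  (T.localEquiv c).apply_symm_apply _

theorem lower_toPoly (c : Cell N) (j : Fin 3) (d : Coord N) :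
    T.midpointValue (c.lower j) (T.toPoly d c) = gridVal c j d := by
  rw [← T.localMap_snd, localMap_toPoly]

theorem upper_toPoly (c : Cell N) (j : Fin 3) (d : Coord N) :
    T.midpointValue (c.upper j) (T.toPoly d c) = d.1 c - gridVal c j d := by
  have h := T.localMap_fst c (T.toPoly d c) j
  rw [localMap_toPoly, lower_toPoly] at h
  linarith

theorem toPoly_injective : Function.Injective T.toPoly := by
  rw [← LinearMap.ker_eq_bot, LinearMap.ker_eq_bot']
  intro d hd
  have h : ∀ c, (d.1 c, fun j => gridVal c j d) = ((0, 0) : ℝ × (Fin 3 → ℝ)) := fun c => by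
    rw [← T.localMap_toPoly, hd]
    exact map_zero _
  refine Prod.ext (funext fun c => (Prod.mk.inj (h c)).1) (funext fun q => ?_)
  rw [← gridVal_first]
  exact congrFun (Prod.mk.inj (h q.1.2.1)).2 q.1.1

/-- The continuity conditions on the interior faces. -/
def Conforms (P : Cell N → P1) : Prop :=
  ∀ (c : Cell N) (j : Fin 3) (c' : Cell N), c.Next j c' →
    T.midpointValue (c.upper j) (P c) = T.midpointValue (c.upper j) (P c')

theorem conforms_toPoly (d : Coord N) : T.Conforms (T.toPoly d) := by
  intro c j c' h
  rw [upper_toPoly, next_upper_eq_lower h, lower_toPoly, gridVal_next h]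

theorem Conforms.exists_eq_toPoly {P : Cell N → P1} (hP : T.Conforms P) :
    ∃ d, T.toPoly d = P := by
  let d : Coord N := (fun c => (T.localMap c (P c)).1,
    fun q => T.midpointValue (q.1.2.1.lower q.1.1) (P q.1.2.1))
  have key : ∀ (n : ℕ) (c : Cell N) (j : Fin 3), c.1 j = n →
      T.midpointValue (c.lower j) (P c) = gridVal c j d := by
    intro n
    induction n with
    | zero =>
      intro c j hc
      have h1 : (c.row j).1.2.1 = c := by
        apply Subtype.ext
        simp [Cell.row, ← hc]
      have h2 := gridVal_first (c.row j) d
      change gridVal (c.row j).1.2.1 j d =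
        T.midpointValue ((c.row j).1.2.1.lower j) (P (c.row j).1.2.1) at h2
      rw [h1] at h2
      exact h2.symm
    | succ n ih =>
      intro c j hc
      obtain ⟨c', h1, h2⟩ := exists_prev (c := c) (j := j) (by omega)
      rw [gridVal_next h1, ← ih c' j (by omega), ← next_upper_eq_lower h1, ← hP c' j c h1]
      have := T.localMap_fst c' (P c') j
      change T.midpointValue (c'.upper j) (P c') = (T.localMap c' (P c')).1 - _
      linarith
  refine ⟨d, funext fun c => T.localMap_injective c ?_⟩
  rw [localMap_toPoly]
  exact Prod.ext rfl (funext fun j => (key _ c j rfl).symm)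

theorem bc_toPoly (q : OppPair N) (d : Coord N) :
    T.midpointValue (q.1.2.1.lower q.1.1) (T.toPoly d q.1.2.1) =
      T.midpointValue (q.1.2.2.upper q.1.1) (T.toPoly d q.1.2.2) ↔ bc q d = 0 := by
  rw [lower_toPoly, upper_toPoly, ← gridVal_last]
  constructor <;> intro h <;> linarith

/-! ### Piecewise linear functions as elements of `L²` -/

theorem isCompact_cell (c : Cell N) : IsCompact (T.cell c) :=
  ((c.corners.finite_toSet).image _).isCompact_convexHull ℝ

theorem exists_hyperplane_inter {c c' : Cell N} (h : c ≠ c') :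
    ∃ (φ : E3 →ₗ[ℝ] ℝ) (r : ℝ), φ ≠ 0 ∧ ∀ x ∈ T.cell c ∩ T.cell c', φ x = r := by
  have H : ∃ (j : Fin 3) (t : ℕ), (t = c.1 j ∨ t = c.1 j + 1) ∧
      ∀ p ∈ c.corners ∩ c'.corners, p j = t := by
    obtain ⟨j, hj⟩ := Function.ne_iff.1 fun h' => h (Subtype.ext h')
    simp only [Finset.mem_inter, mem_cell_corners]
    rcases lt_or_gt_of_ne hj with hlt | hlt
    · exact ⟨j, _, Or.inr rfl, fun p hp => by have := hp.1 j; have := hp.2 j; omega⟩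
    · exact ⟨j, _, Or.inl rfl, fun p hp => by have := hp.1 j; have := hp.2 j; omega⟩
  obtain ⟨j, t, ht, hp⟩ := H
  obtain ⟨φ, r, hφ, hr⟩ := T.exists_support c j ht
  refine ⟨φ, r, hφ, ?_⟩
  rw [cell, cell, T.conforming]
  have hsub : convexHull ℝ (T.node '' ((c.corners ∩ c'.corners : Finset _) : Set (Fin 3 → ℕ))) ⊆
      {x | φ x = r} := by
    refine convexHull_min ?_ (convex_hyperplane φ.isLinear r)
    rintro _ ⟨p, hp', rfl⟩
    exact (hr p (Finset.mem_inter.1 hp').1).1 (hp p hp')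
  exact fun x hx => hsub hx

theorem volume_hyperplane {φ : E3 →ₗ[ℝ] ℝ} (hφ : φ ≠ 0) (r : ℝ) :
    volume {x : E3 | φ x = r} = 0 := by
  obtain ⟨x₀, hx₀⟩ := LinearMap.surjective hφ r
  have h : {x : E3 | φ x = r} = (fun x => x - x₀) ⁻¹' (LinearMap.ker φ : Set E3) := by
    ext x
    simp [LinearMap.mem_ker, hx₀, sub_eq_zero]
  simp_rw [h, sub_eq_add_neg]
  rw [measure_preimage_add_right]
  refine Measure.addHaar_submodule _ _ fun htop => hφ ?_
  exact LinearMap.ker_eq_top.1 htop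

theorem volume_inter_cell {c c' : Cell N} (h : c ≠ c') :
    volume (T.cell c ∩ T.cell c') = 0 := by
  obtain ⟨φ, r, hφ, hr⟩ := T.exists_hyperplane_inter h
  exact measure_mono_null (fun x hx => hr x hx) (volume_hyperplane hφ r)

theorem isOpen_box (ℓ : Fin 3 → ℝ) : IsOpen (box ℓ) := by
  rw [box, Set.ofPred_forall]
  refine isOpen_iInter_of_finite fun k => ?_
  have hk : Continuous fun x : E3 => x k := by fun_prop
  exact (isOpen_lt continuous_const hk).inter (isOpen_lt hk continuous_const)

theorem box_subset_iUnion : box ℓ ⊆ ⋃ c, T.cell c := by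
  intro x hx
  have : x ∈ closedBox ℓ := fun k => ⟨(hx k).1.le, (hx k).2.le⟩
  rwa [← T.cover] at this

theorem interior_cell_subset_box (c : Cell N) : interior (T.cell c) ⊆ box ℓ := by
  have hsub : T.cell c ⊆ closedBox ℓ := by
    rw [← T.cover]
    exact Set.subset_iUnion (fun c => T.cell c) c
  intro x hx k
  have hnhds : closedBox ℓ ∈ nhds x := Filter.mem_of_superset (mem_interior_iff_mem_nhds.1 hx) hsub
  have hcont : Filter.Tendsto (fun t : ℝ => x + t • (EuclideanSpace.single k (1 : ℝ) : E3))
      (nhds 0) (nhds x) := by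
    have : Continuous (fun t : ℝ => x + t • (EuclideanSpace.single k (1 : ℝ) : E3)) := by fun_prop
    simpa using this.tendsto 0
  obtain ⟨ε, hε, hball⟩ := Metric.mem_nhds_iff.1 (hcont hnhds)
  have h1 := hball (show ε / 2 ∈ Metric.ball (0 : ℝ) ε by
    rw [Metric.mem_ball, dist_zero_right, Real.norm_eq_abs, abs_of_pos (by linarith)]; linarith) k
  have h2 := hball (show -(ε / 2) ∈ Metric.ball (0 : ℝ) ε by
    rw [Metric.mem_ball, dist_zero_right, Real.norm_eq_abs, abs_neg, abs_of_pos (by linarith)]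
    linarith) k
  simp at h1 h2
  constructor <;> linarith [h1.1, h1.2, h2.1, h2.2]

theorem isFiniteMeasure_box (T : HexMesh ℓ N) :
    IsFiniteMeasure ((volume : Measure E3).restrict (box ℓ)) := by
  refine ⟨?_⟩
  rw [Measure.restrict_apply_univ]
  exact (measure_mono T.box_subset_iUnion).trans_lt
    (isCompact_iUnion T.isCompact_cell).measure_lt_top

theorem exists_piecewiseP1 (P : Cell N → P1) : ∃ v, T.PiecewiseP1 v P := by
  have := T.isFiniteMeasure_box
  let F : E3 → ℝ := fun x => ∑ c, (T.cell c).indicator (fun x => P c x) x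
  have hF : MemLp F 2 ((volume : Measure E3).restrict (box ℓ)) := by
    refine memLp_finsetSum _ fun c _ => ?_
    have hu : Continuous (fun x => P c x) := (P c).continuous_of_finiteDimensional
    obtain ⟨C, hC⟩ := (T.isCompact_cell c).exists_bound_of_continuousOn hu.continuousOn
    refine MemLp.of_bound (hu.measurable.indicator
      (T.isCompact_cell c).measurableSet).aestronglyMeasurable (max C 0)
      (Filter.Eventually.of_forall fun x => ?_)
    by_cases hx : x ∈ T.cell c
    · rw [Set.indicator_of_mem hx]
      exact (hC x hx).trans (le_max_left _ _)
    · rw [Set.indicator_of_notMem hx, norm_zero]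
      exact le_max_right _ _
  refine ⟨hF.toLp F, fun c => ?_⟩
  have hnull : ∀ᵐ x ∂((volume : Measure E3).restrict (box ℓ)), ∀ c' : Cell N, c ≠ c' →
      x ∉ T.cell c ∩ T.cell c' := by
    rw [ae_all_iff]
    intro c'
    by_cases h : c = c'
    · simp [h]
    · refine ae_restrict_of_ae ?_
      filter_upwards [measure_eq_zero_iff_ae_notMem.1 (T.volume_inter_cell h)] with x hx _
      exact hx
  filter_upwards [hF.coeFn_toLp, hnull] with x h1 h2 hx
  rw [h1]
  dsimp only [F]
  rw [Finset.sum_eq_single c, Set.indicator_of_mem hx]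
  · intro c' _ hc'
    exact Set.indicator_of_notMem (fun hx' => h2 c' hc'.symm ⟨hx, hx'⟩) _
  · simp

variable {T}

theorem PiecewiseP1.unique {v w : L2 ℓ} {P : Cell N → P1} (hv : T.PiecewiseP1 v P)
    (hw : T.PiecewiseP1 w P) : v = w := by
  refine Lp.ext ?_
  filter_upwards [ae_all_iff.2 hv, ae_all_iff.2 hw, ae_restrict_mem (isOpen_box ℓ).measurableSet]
    with x h1 h2 hx
  obtain ⟨c, hc⟩ := Set.mem_iUnion.1 (T.box_subset_iUnion hx)
  rw [h1 c hc, h2 c hc]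

theorem PiecewiseP1.unique_poly {v : L2 ℓ} {P Q : Cell N → P1} (hP : T.PiecewiseP1 v P)
    (hQ : T.PiecewiseP1 v Q) : P = Q := by
  funext c
  have hae : (fun x => P c x) =ᵐ[(volume : Measure E3).restrict (interior (T.cell c))]
      fun x => Q c x := by
    filter_upwards [ae_restrict_of_ae_restrict_of_subset (T.interior_cell_subset_box c) (hP c),
      ae_restrict_of_ae_restrict_of_subset (T.interior_cell_subset_box c) (hQ c),
      ae_restrict_mem isOpen_interior.measurableSet] with x h1 h2 hx
    rw [← h1 (interior_subset hx), ← h2 (interior_subset hx)]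
  have heq := Measure.eqOn_open_of_ae_eq hae isOpen_interior
    (P c).continuous_of_finiteDimensional.continuousOn
    (Q c).continuous_of_finiteDimensional.continuousOn
  exact AffineMap.ext_on (isOpen_interior.affineSpan_eq_top (T.interior_cell_nonempty c)) heq

variable (T)

/-- The element of `L²` with given coordinates. -/
def toL2 : Coord N →ₗ[ℝ] L2 ℓ where
  toFun d := (T.exists_piecewiseP1 (T.toPoly d)).choose
  map_add' d e := by
    refine PiecewiseP1.unique (T.exists_piecewiseP1 _).choose_spec ?_
    rw [map_add]
    exact (T.exists_piecewiseP1 _).choose_spec.add (T.exists_piecewiseP1 _).choose_spec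
  map_smul' a d := by
    refine PiecewiseP1.unique (T.exists_piecewiseP1 _).choose_spec ?_
    rw [map_smul]
    exact (T.exists_piecewiseP1 _).choose_spec.smul a

theorem piecewiseP1_toL2 (d : Coord N) : T.PiecewiseP1 (T.toL2 d) (T.toPoly d) :=
  (T.exists_piecewiseP1 (T.toPoly d)).choose_spec

theorem toL2_injective : Function.Injective T.toL2 := by
  intro d e h
  refine T.toPoly_injective ((T.piecewiseP1_toL2 d).unique_poly ?_)
  rw [h]
  exact T.piecewiseP1_toL2 e

theorem mem_V {v : L2 ℓ} : v ∈ T.V T.midpointValue ↔ ∃ d, T.toL2 d = v := by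
  constructor
  · rintro ⟨P, hv, hP⟩
    obtain ⟨d, rfl⟩ := Conforms.exists_eq_toPoly T hP
    exact ⟨d, (T.piecewiseP1_toL2 d).unique hv⟩
  · rintro ⟨d, rfl⟩
    exact ⟨_, T.piecewiseP1_toL2 d, T.conforms_toPoly d⟩

theorem periodicBC_toL2 (q : OppPair N) (d : Coord N) :
    T.PeriodicBC T.midpointValue q (T.toL2 d) ↔ bc q d = 0 := by
  rw [← T.bc_toPoly]
  constructor
  · rintro ⟨P, hP, h⟩
    rwa [hP.unique_poly (T.piecewiseP1_toL2 d)] at h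
  · intro h
    exact ⟨_, T.piecewiseP1_toL2 d, h⟩

theorem inducesAll_iff (S : Finset (OppPair N)) : T.InducesAll T.midpointValue S ↔
    ∀ d : Coord N, (∀ q ∈ S, bc q d = 0) → ∀ q, bc q d = 0 := by
  constructor
  · intro h d hd q
    rw [← T.periodicBC_toL2]
    exact h _ (T.mem_V.2 ⟨d, rfl⟩) (fun q hq => (T.periodicBC_toL2 q d).2 (hd q hq)) q
  · intro h v hv hS q
    obtain ⟨d, rfl⟩ := T.mem_V.1 hv
    rw [T.periodicBC_toL2]
    exact h d (fun q hq => (T.periodicBC_toL2 q d).1 (hS q hq)) q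

theorem Vper_eq : T.Vper T.midpointValue =
    (⨅ q, LinearMap.ker (bc q) : Submodule ℝ (Coord N)).map T.toL2 := by
  ext v
  simp only [Submodule.mem_map, Submodule.mem_iInf, LinearMap.mem_ker]
  constructor
  · rintro ⟨hv, hv'⟩
    obtain ⟨d, rfl⟩ := T.mem_V.1 hv
    exact ⟨d, fun q => (T.periodicBC_toL2 q d).1 (hv' q), rfl⟩
  · rintro ⟨d, hd, rfl⟩
    exact ⟨T.mem_V.2 ⟨d, rfl⟩, fun q => (T.periodicBC_toL2 q d).2 (hd q)⟩

theorem finrank_Vper : Module.finrank ℝ (T.Vper T.midpointValue) =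
    ∏ k, (N k - natParity (N k)) + ∑ j, natParity (N j) * ∏ k ∈ Finset.univ.erase j, N k := by
  rw [Vper_eq, ← (Submodule.equivMapOfInjective T.toL2 T.toL2_injective _).finrank_eq,
    finrank_iInf_ker_bc T.count_pos, finrank_evenKer T.count_pos]

theorem card_add_finrank_Vper {S : Finset (OppPair N)}
    (hS : T.MinimallyEssential T.midpointValue S) :
    S.card + Module.finrank ℝ (T.Vper T.midpointValue) =
      ∏ k, N k + ∑ j, ∏ k ∈ Finset.univ.erase j, N k := by
  classical
  have h := finrank_eq_card_add_of_minimal (fun q : OppPair N => bc q) S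
    ((T.inducesAll_iff S).1 hS.1) fun S' hS' h' => hS.2 S' hS' ((T.inducesAll_iff S').2 h')
  rw [Vper_eq, ← (Submodule.equivMapOfInjective T.toL2 T.toL2_injective _).finrank_eq, ← h,
    Module.finrank_prod, Module.finrank_fintype_fun_eq_card, Module.finrank_fintype_fun_eq_card,
    card_cell, card_oppPair T.count_pos]

theorem exists_minimallyEssential (σ : Face N → P1 →ₗ[ℝ] ℝ) :
    ∃ S : Finset (OppPair N), T.MinimallyEssential σ S := by
  obtain ⟨S, hS⟩ := (Set.toFinite {S : Finset (OppPair N) | T.InducesAll σ S}).exists_minimal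
    ⟨Finset.univ, fun v _ h q => h q (Finset.mem_univ q)⟩
  exact ⟨S, hS.prop, fun S' hS' h => hS.not_lt h hS'⟩

end HexMesh

theorem parity_eq (n : ℕ) : parity n = natParity n := by
  rw [parity, natParity]
  split_ifs with h
  · rw [h.neg_one_pow]; norm_num
  · rw [(Nat.not_even_iff_odd.1 h).neg_one_pow]; norm_num

theorem natParity_le {n : ℕ} (h : 0 < n) : natParity n ≤ n := by
  rw [natParity]
  split_ifs <;> omega

end PeriodicP1NC

end

theorem proposition6p3 (ℓ : Fin 3 → ℝ) (Nx Ny Nz : ℕ)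
    (T : PeriodicP1NC.HexMesh ℓ ![Nx, Ny, Nz])
    (σ : PeriodicP1NC.Face ![Nx, Ny, Nz] → PeriodicP1NC.P1 →ₗ[ℝ] ℝ)
    (hσ : (T.IsParallelepiped ∧ σ = T.faceAverage) ∨ σ = T.midpointValue) :
    (∃ S : Finset (PeriodicP1NC.OppPair ![Nx, Ny, Nz]), T.MinimallyEssential σ S) ∧
    (∀ S : Finset (PeriodicP1NC.OppPair ![Nx, Ny, Nz]), T.MinimallyEssential σ S →
      (S.card : ℚ) = (Nx * Ny + Ny * Nz + Nz * Nx) -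
        (Nx * PeriodicP1NC.parity Ny * PeriodicP1NC.parity Nz
          + Ny * PeriodicP1NC.parity Nx * PeriodicP1NC.parity Nz
          + Nz * PeriodicP1NC.parity Nx * PeriodicP1NC.parity Ny
          - PeriodicP1NC.parity Nx * PeriodicP1NC.parity Ny * PeriodicP1NC.parity Nz)) ∧
    FiniteDimensional ℝ (T.Vper σ) ∧
    (Module.finrank ℝ (T.Vper σ) : ℚ) = Nx * Ny * Nz +
        (Nx * PeriodicP1NC.parity Ny * PeriodicP1NC.parity Nz
          + Ny * PeriodicP1NC.parity Nx * PeriodicP1NC.parity Nz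
          + Nz * PeriodicP1NC.parity Nx * PeriodicP1NC.parity Ny
          - PeriodicP1NC.parity Nx * PeriodicP1NC.parity Ny * PeriodicP1NC.parity Nz) := by
  have hσ' : σ = T.midpointValue := by
    rcases hσ with ⟨h1, h2⟩ | h
    · rw [h2, T.faceAverage_eq_midpointValue h1]
    · exact h
  subst hσ'
  have hx := PeriodicP1NC.natParity_le (T.count_pos 0)
  have hy := PeriodicP1NC.natParity_le (T.count_pos 1)
  have hz := PeriodicP1NC.natParity_le (T.count_pos 2)
  simp only [Matrix.cons_val] at hx hy hz
  have e0 : (Finset.univ.erase 0 : Finset (Fin 3)) = {1, 2} := by decide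
  have e1 : (Finset.univ.erase 1 : Finset (Fin 3)) = {0, 2} := by decide
  have e2 : (Finset.univ.erase 2 : Finset (Fin 3)) = {0, 1} := by decide
  have hdim : (Module.finrank ℝ (T.Vper T.midpointValue) : ℚ) = Nx * Ny * Nz +
        (Nx * PeriodicP1NC.parity Ny * PeriodicP1NC.parity Nz
          + Ny * PeriodicP1NC.parity Nx * PeriodicP1NC.parity Nz
          + Nz * PeriodicP1NC.parity Nx * PeriodicP1NC.parity Ny
          - PeriodicP1NC.parity Nx * PeriodicP1NC.parity Ny * PeriodicP1NC.parity Nz) := by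
    rw [T.finrank_Vper, Fin.prod_univ_three, Fin.sum_univ_three, e0, e1, e2]
    simp only [Matrix.cons_val, PeriodicP1NC.parity_eq]
    rw [Finset.prod_pair (by decide), Finset.prod_pair (by decide), Finset.prod_pair (by decide)]
    simp only [Matrix.cons_val]
    push_cast [hx, hy, hz]
    ring
  refine ⟨T.exists_minimallyEssential _, fun S hS => ?_, ?_, hdim⟩
  · have h := congrArg (Nat.cast (R := ℚ)) (T.card_add_finrank_Vper hS)
    rw [Fin.prod_univ_three, Fin.sum_univ_three, e0, e1, e2, Finset.prod_pair (by decide),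
      Finset.prod_pair (by decide), Finset.prod_pair (by decide), Nat.cast_add, hdim] at h
    simp only [Matrix.cons_val] at h
    push_cast at h
    linarith
  · rw [T.Vper_eq]
    infer_instance
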